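/- Let $n\in\{1,2,\dots\}\cup\{\infty\}$ and let $\mathbb F_n^+$ be the free unital semigroup on generators $g_i$ ($1\le i\le n$, or $i\in\mathbb N$ if $n=\infty$) with identity $g_0$; write $|\alpha|$ for the length of a word $\alpha$, and for an $n$-tuple $A=(A_i)$ of bounded operators put $A_\alpha:=A_{i_1}\cdots A_{i_k}$ if $\alpha=g_{i_1}\cdots g_{i_k}$ and $A_{g_0}:=I$. Let $m\ge 1$ be an integer and let $f=\sum_{|\alpha|\ge1}a_\alpha X_\alpha$ be a positive regular free holomorphic function: $a_\alpha\ge 0$ for all $\alpha$, $a_{g_0}=0$, $a_{g_i}>0$ for all $i$, and $\limsup_{k\to\infty}\big(\sum_{|\alpha|=k}|a_\alpha|^2\big)^{1/2k}<\infty$. Put $b_{g_0}:=1$ and $$b_\alpha:=\sum_{j=1}^{|\alpha|}\ \sum_{\gamma_1\cdots\gamma_j=\alpha,\ |\gamma_1|,\dots,|\gamma_j|\ge1}a_{\gamma_1}\cdots a_{\gamma_j}\binom{j+m-1}{m-1},\qquad |\alpha|\ge1.$$ Let $F^2$ be the full Fock space with orthonormal basis $\{e_\alpha\}_{\alpha\in\mathbb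 F_n^+}$ and let $W_i\in B(F^2)$ be the weighted left creation operators $W_ie_\alpha:=\sqrt{b_\alpha/b_{g_i\alpha}}\;e_{g_i\alpha}$. For a family $\mathcal P$ of noncommutative polynomials in $n$ indeterminates with complex coefficients let $$\mathcal M_{\mathcal P}:=\overline{\mathrm{span}}\{W_\alpha\, p(W)\, W_\beta e_{g_0}:\ p\in\mathcal P,\ \alpha,\beta\in\mathbb F_n^+\},\qquad \mathcal N_{\mathcal P}:=F^2\ominus\mathcal M_{\mathcal P},\qquad B_i:=P_{\mathcal N_{\mathcal P}}W_i|_{\mathcal N_{\mathcal P}},$$ and assume $\mathcal N_{\mathcal P}\ne\{0\}$. Let $\mathcal H$ be a complex Hilbert space and let $A=(A_i)$ be an $n$-tuple in $B(\mathcal H)$ such that $\sum_{|\alpha|\ge1}a_\alpha A_\alpha A_\alpha^*$ converges in the weak operator topology and $p(A)=0$ for all $p\in\mathcal P$. Set $$\Phi_{f,A}(X):=\sum_{|\alpha|\ge1}a_\alpha A_\alpha XA_\alpha^*,\qquad X\in B(\mathcal H)$$ (convergence in the weak operator topology), and let $C(f,A)^+$ be the set of all positive operators $D\in B(\mathcal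 H)$ with $(\mathrm{id}-\Phi_{f,A})^s(D)\ge0$ for $s=1,\dots,m$. Then the following statements are equivalent. (i) There are a closed subspace $\mathcal G\subseteq\mathcal N_{\mathcal P}\otimes\mathcal H$ (Hilbert space tensor product), invariant under each operator $B_i^*\otimes I_{\mathcal H}$, and an invertible bounded operator $Y:\mathcal H\to\mathcal G$ such that $$A_i^*=Y^{-1}\big[(B_i^*\otimes I_{\mathcal H})|_{\mathcal G}\big]Y\qquad\text{for all } i.$$ (ii) There is an invertible operator $Q\in C(f,A)^+$ such that $\Phi_{f,A}^k(Q)\to0$ strongly as $k\to\infty$. (iii) There are constants $0<a\le b$ and a positive operator $R\in B(\mathcal H)$ such that the series below converges in the weak operator topology and $$aI\le\sum_{k=0}^\infty\binom{k+m-1}{m-1}\Phi_{f,A}^k(R)\le bI.$$ -/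

import Mathlib

open scoped TensorProduct ENNReal InnerProductSpace

namespace NCVariety

/-! ### Words and positive regular free holomorphic functions

The free semigroup on generators `g_i`, `i : ι`, is `FreeMonoid ι`: its identity is `1`, its
generators are `FreeMonoid.of i`, and the length of a word is `FreeMonoid.length`.  A formal power
series `f = ∑ a_α X_α` is given by its coefficient function `a : FreeMonoid ι → ℝ`. -/

/-- `f = ∑ a_α X_α` is a positive regular free holomorphic function:
`limsup_k (∑_{|α| = k} |a_α|²)^{1/2k} < ∞`, all coefficients are nonnegative, the constant
coefficient is zero and the coefficients of the variables are positive. -/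
structure PositiveRegular {ι : Type*} (a : FreeMonoid ι → ℝ) : Prop where
  limsup_lt_top :
    Filter.limsup (fun k : ℕ =>
      (∑' α : {α : FreeMonoid ι // α.length = k}, ENNReal.ofReal (|a α| ^ 2)) ^
        (1 / (2 * (k : ℝ)))) Filter.atTop < ⊤
  nonneg : ∀ α, 0 ≤ a α
  coeff_one : a 1 = 0
  coeff_of_pos : ∀ i, 0 < a (FreeMonoid.of i)

/-- All factorizations `α = γ₁ ⋯ γ_j` of a word into `j` nonempty words. -/
def factorizations {ι : Type*} (j : ℕ) (α : FreeMonoid ι) : Set (List (FreeMonoid ι)) :=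
  {L | L.length = j ∧ (∀ γ ∈ L, 1 ≤ γ.length) ∧ L.prod = α}

lemma factorizations_finite {ι : Type*} (j : ℕ) (α : FreeMonoid ι) :
    (factorizations j α).Finite := by
  induction j generalizing α with
  | zero =>
    refine (Set.finite_singleton ([] : List (FreeMonoid ι))).subset ?_
    rintro L ⟨hL, -, -⟩
    simpa using hL
  | succ j ih =>
    have hfin : (⋃ k ∈ Finset.range (α.length + 1),
        (fun L => FreeMonoid.ofList (α.toList.take k) :: L) ''
          factorizations j (FreeMonoid.ofList (α.toList.drop k))).Finite :=
      Set.Finite.biUnion (Finset.finite_toSet _) fun k _ => (ih _).image _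
    refine hfin.subset ?_
    rintro L ⟨hL, hne, hprod⟩
    cases L with
    | nil => simp at hL
    | cons γ L =>
      have hα : α.toList = γ.toList ++ L.prod.toList := by
        rw [← hprod, List.prod_cons, FreeMonoid.toList_mul]
      have hlen : γ.toList.length ≤ α.length := by
        change _ ≤ α.toList.length
        rw [hα]; simp
      simp only [Set.mem_iUnion]
      refine ⟨γ.toList.length, by simpa using Nat.lt_succ_of_le hlen, L, ⟨?_, ?_, ?_⟩, ?_⟩
      · simpa using hL
      · exact fun δ hδ => hne δ (List.mem_cons_of_mem _ hδ)
      · rw [hα, List.drop_left]; rfl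
      · simp only [hα, List.take_left]; rfl

/-- The weights: `b_1 = 1` for the empty word and
`b_α = ∑_{j=1}^{|α|} (∑_{γ₁⋯γ_j = α, |γ_i| ≥ 1} a_{γ₁} ⋯ a_{γ_j}) * choose (j+m-1) (m-1)`
for `|α| ≥ 1`. -/
noncomputable def weight {ι : Type*} (a : FreeMonoid ι → ℝ) (m : ℕ) (α : FreeMonoid ι) : ℝ :=
  if α.length = 0 then 1
  else ∑ j ∈ Finset.Icc 1 α.length,
    (∑ᶠ L ∈ factorizations j α, (L.map a).prod) * ((j + m - 1).choose (m - 1) : ℝ)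

lemma factorSum_nonneg {ι : Type*} {a : FreeMonoid ι → ℝ} (ha : PositiveRegular a)
    (j : ℕ) (α : FreeMonoid ι) : 0 ≤ ∑ᶠ L ∈ factorizations j α, (L.map a).prod := by
  refine finsum_nonneg fun L => finsum_nonneg fun _ => List.prod_nonneg ?_
  simp only [List.mem_map, forall_exists_index, and_imp]
  rintro _ γ - rfl
  exact ha.nonneg γ

lemma weight_nonneg {ι : Type*} {a : FreeMonoid ι → ℝ} (ha : PositiveRegular a)
    (m : ℕ) (α : FreeMonoid ι) : 0 ≤ weight a m α := by
  unfold weight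
  split_ifs
  · exact zero_le_one
  · exact Finset.sum_nonneg fun j _ => mul_nonneg (factorSum_nonneg ha j α) (by positivity)

lemma factorSum_of_mul {ι : Type*} {a : FreeMonoid ι → ℝ} (ha : PositiveRegular a)
    (i : ι) (j : ℕ) (α : FreeMonoid ι) :
    a (FreeMonoid.of i) * ∑ᶠ L ∈ factorizations j α, (L.map a).prod ≤
      ∑ᶠ L ∈ factorizations (j + 1) (FreeMonoid.of i * α), (L.map a).prod := by
  classical
  rw [finsum_mem_eq_finite_toFinset_sum _ (factorizations_finite j α),
    finsum_mem_eq_finite_toFinset_sum _ (factorizations_finite (j + 1) _), Finset.mul_sum]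
  calc _ = ∑ L ∈ (factorizations_finite j α).toFinset.image (fun L => FreeMonoid.of i :: L),
        (L.map a).prod := by
        rw [Finset.sum_image (fun _ _ _ _ h => (List.cons.inj h).2)]
        simp
    _ ≤ _ := by
        refine Finset.sum_le_sum_of_subset_of_nonneg ?_ ?_
        · intro L hL
          simp only [Finset.mem_image, Set.Finite.mem_toFinset] at hL ⊢
          obtain ⟨L, ⟨h1, h2, h3⟩, rfl⟩ := hL
          refine ⟨by simp [h1], ?_, by simp [h3]⟩
          intro γ hγ
          rcases List.mem_cons.1 hγ with rfl | hγ
          · simp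
          · exact h2 γ hγ
        · intro L _ _
          refine List.prod_nonneg ?_
          simp only [List.mem_map, forall_exists_index, and_imp]
          rintro _ γ - rfl
          exact ha.nonneg γ

lemma weight_of_mul {ι : Type*} {a : FreeMonoid ι → ℝ} (ha : PositiveRegular a)
    (m : ℕ) (i : ι) (α : FreeMonoid ι) :
    a (FreeMonoid.of i) * weight a m α ≤ weight a m (FreeMonoid.of i * α) := by
  have hlen : (FreeMonoid.of i * α).length = α.length + 1 := by
    rw [FreeMonoid.length_mul, FreeMonoid.length_of, add_comm]
  have hterm : ∀ j, 0 ≤ (∑ᶠ L ∈ factorizations j (FreeMonoid.of i * α), (L.map a).prod) *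
      ((j + m - 1).choose (m - 1) : ℝ) := fun j =>
    mul_nonneg (factorSum_nonneg ha _ _) (by positivity)
  have hchoose : ∀ j : ℕ, ((j + m - 1).choose (m - 1) : ℝ) ≤ ((j + 1 + m - 1).choose (m - 1) : ℝ) :=
    fun j => by exact_mod_cast Nat.choose_le_choose _ (by omega)
  have hstep : ∀ j : ℕ,
      a (FreeMonoid.of i) * ((∑ᶠ L ∈ factorizations j α, (L.map a).prod) *
        ((j + m - 1).choose (m - 1) : ℝ)) ≤
      (∑ᶠ L ∈ factorizations (j + 1) (FreeMonoid.of i * α), (L.map a).prod) *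
        ((j + 1 + m - 1).choose (m - 1) : ℝ) := fun j => by
    rw [← mul_assoc]
    exact mul_le_mul (factorSum_of_mul ha i j α) (hchoose j) (by positivity)
      (factorSum_nonneg ha _ _)
  have hR : weight a m (FreeMonoid.of i * α) = ∑ j ∈ Finset.range (α.length + 1),
      (∑ᶠ L ∈ factorizations (j + 1) (FreeMonoid.of i * α), (L.map a).prod) *
        ((j + 1 + m - 1).choose (m - 1) : ℝ) := by
    unfold weight
    rw [if_neg (by omega), hlen, Finset.range_eq_Ico,
      Finset.sum_Ico_add' (fun j => (∑ᶠ L ∈ factorizations j (FreeMonoid.of i * α),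
        (L.map a).prod) * ((j + m - 1).choose (m - 1) : ℝ)) 0 (α.length + 1) 1]
    rfl
  rw [hR]
  by_cases h0 : α.length = 0
  · have hα : α = 1 := FreeMonoid.length_eq_zero.1 h0
    subst hα
    have h := hstep 0
    have hS : (∑ᶠ L ∈ factorizations 0 (1 : FreeMonoid ι), (L.map a).prod) = 1 := by
      have : factorizations 0 (1 : FreeMonoid ι) = {[]} := by
        ext L
        constructor
        · rintro ⟨h, -, -⟩
          simpa using h
        · rintro rfl
          exact ⟨rfl, by simp, rfl⟩
      rw [this, finsum_mem_singleton]
      simp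
    have hC : ((0 + m - 1).choose (m - 1) : ℝ) = 1 := by simp
    rw [hS, hC, mul_one] at h
    simpa [weight] using h
  · rw [weight, if_neg h0, Finset.mul_sum, Finset.sum_range_succ']
    refine le_trans ?_ (Finset.sum_le_sum_of_subset_of_nonneg
      (s := Finset.Icc 1 α.length) (t := Finset.range (α.length + 1))
      (f := fun j => (∑ᶠ L ∈ factorizations (j + 1) (FreeMonoid.of i * α), (L.map a).prod) *
        ((j + 1 + m - 1).choose (m - 1) : ℝ)) ?_ ?_ |>.trans_eq (Finset.sum_range_succ' _ _))
    · exact Finset.sum_le_sum fun j _ => hstep j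
    · intro j hj
      simp only [Finset.mem_Icc, Finset.mem_range] at *
      omega
    · exact fun j _ _ => hterm (j + 1)

/-! ### The full Fock space and the weighted left creation operators -/

/-- The full Fock space, as `ℓ²` over the words; `e_α` below is its canonical orthonormal basis. -/
abbrev Fock (ι : Type*) : Type _ := lp (fun _ : FreeMonoid ι => ℂ) 2

open Classical in
/-- The basis vector `e_α`; `basisVec 1` is the vacuum vector `1`. -/
noncomputable def basisVec {ι : Type*} (α : FreeMonoid ι) : Fock ι :=
  lp.single 2 α (1 : ℂ)

lemma orthonormal_basisVec_of_mul {ι : Type*} (i : ι) :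
    Orthonormal ℂ (fun α : FreeMonoid ι => basisVec (FreeMonoid.of i * α)) := by
  classical
  rw [orthonormal_iff_ite]
  intro α β
  rw [basisVec, lp.inner_single_left, basisVec, lp.single_apply]
  by_cases h : α = β
  · subst h; simp
  · have : FreeMonoid.of i * α ≠ FreeMonoid.of i * β := fun h' => h (mul_left_cancel h')
    simp [this, h]

/-- The left creation operator `S_i`, i.e. the isometry with `S_i e_α = e_{g_i α}`. -/
noncomputable def leftCreation {ι : Type*} (i : ι) : Fock ι →L[ℂ] Fock ι :=
  (orthonormal_basisVec_of_mul i).orthogonalFamily.linearIsometry.toContinuousLinearMap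

/-- The bounded diagonal operator on the Fock space with diagonal entries `d α`. -/
noncomputable def diagonalOp {ι : Type*} (d : FreeMonoid ι → ℝ) (C : ℝ)
    (hd : ∀ α, |d α| ≤ C) : Fock ι →L[ℂ] Fock ι :=
  have hle : ∀ (x : Fock ι) α, ‖(d α : ℂ) * x α‖ ≤ ‖((C : ℂ) • x) α‖ := fun x α => by
    simp only [lp.coeFn_smul, Pi.smul_apply, norm_smul, norm_mul, Complex.norm_real,
      Real.norm_eq_abs]
    exact mul_le_mul_of_nonneg_right ((hd α).trans (le_abs_self C)) (norm_nonneg _)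
  have hmem : ∀ x : Fock ι, Memℓp (fun α => (d α : ℂ) * x α) 2 := fun x =>
    (lp.memℓp ((C : ℂ) • x)).mono' (hle x)
  LinearMap.mkContinuous
    { toFun := fun x => ⟨fun α => (d α : ℂ) * x α, hmem x⟩
      map_add' := fun x y => lp.ext (funext fun α => mul_add (d α : ℂ) (x α) (y α))
      map_smul' := fun c x => lp.ext (funext fun α => mul_left_comm (d α : ℂ) c (x α)) }
    |C| (fun x => by
      have h : ‖(C : ℂ) • x‖ = |C| * ‖x‖ := by
        rw [norm_smul, Complex.norm_real, Real.norm_eq_abs]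
      rw [← h]
      exact lp.norm_mono (by norm_num) (hle x))

lemma diagonal_bound {ι : Type*} {a : FreeMonoid ι → ℝ} (ha : PositiveRegular a)
    (m : ℕ) (i : ι) (α : FreeMonoid ι) :
    |√(weight a m α / weight a m (FreeMonoid.of i * α))| ≤ √(1 / a (FreeMonoid.of i)) := by
  rw [abs_of_nonneg (Real.sqrt_nonneg _)]
  refine Real.sqrt_le_sqrt ?_
  have h := weight_of_mul ha m i α
  have hpos := ha.coeff_of_pos i
  rcases (weight_nonneg ha m (FreeMonoid.of i * α)).eq_or_lt with h0 | h0
  · rw [← h0, div_zero]; positivity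
  · rw [div_le_div_iff₀ h0 hpos]; linarith

/-- The weighted left creation operator `W_i = S_i D_i`, with
`D_i e_α = √(b_α / b_{g_i α}) e_α`. -/
noncomputable def weightedShift {ι : Type*} {a : FreeMonoid ι → ℝ} (ha : PositiveRegular a)
    (m : ℕ) (i : ι) : Fock ι →L[ℂ] Fock ι :=
  leftCreation i ∘L
    diagonalOp (fun α => √(weight a m α / weight a m (FreeMonoid.of i * α)))
      (√(1 / a (FreeMonoid.of i))) (diagonal_bound ha m i)

/-! ### Noncommutative polynomials in operators and the universal model of a variety -/

section Operators

variable {ι : Type*} {H : Type*} [NormedAddCommGroup H] [InnerProductSpace ℂ H]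

/-- `A_α = A_{i₁} ⋯ A_{i_k}` for `α = g_{i₁} ⋯ g_{i_k}`, and `A_1 = I`. -/
noncomputable def wordOp (A : ι → H →L[ℂ] H) (α : FreeMonoid ι) : H →L[ℂ] H :=
  FreeMonoid.lift A α

/-- `p(A_1, …, A_n)` for a noncommutative polynomial `p`. -/
noncomputable def polyOp (A : ι → H →L[ℂ] H) (p : FreeAlgebra ℂ ι) : H →L[ℂ] H :=
  FreeAlgebra.lift ℂ A p

end Operators

section Model

variable {ι : Type*} {a : FreeMonoid ι → ℝ} (ha : PositiveRegular a) (m : ℕ)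
  (P : Set (FreeAlgebra ℂ ι))

/-- `M_P`, the closed linear span of all `W_α p(W_1, …, W_n) W_β (1)` with `p ∈ P`. -/
noncomputable def relationSpace : Submodule ℂ (Fock ι) :=
  (Submodule.span ℂ {v | ∃ p ∈ P, ∃ α β : FreeMonoid ι,
    v = (wordOp (weightedShift ha m) α * polyOp (weightedShift ha m) p *
      wordOp (weightedShift ha m) β) (basisVec 1)}).topologicalClosure

/-- `N_P`, the orthogonal complement of `M_P` in the Fock space. -/
noncomputable abbrev modelSpace : Submodule ℂ (Fock ι) := (relationSpace ha m P)ᗮ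

/-- `B_i`, the compression of `W_i` to `N_P`; `(B_i)` is the universal model of the variety. -/
noncomputable def modelOp (i : ι) : modelSpace ha m P →L[ℂ] modelSpace ha m P :=
  (modelSpace ha m P).orthogonalProjectionOnto ∘L weightedShift ha m i ∘L
    (modelSpace ha m P).subtypeL

end Model

/-! ### Hilbert tensor products -/

/-- The Hilbert space tensor product: the completion of the algebraic tensor product with
`⟪x ⊗ y, x' ⊗ y'⟫ = ⟪x, x'⟫ * ⟪y, y'⟫`. -/
abbrev HilbertTensor (E F : Type*) [NormedAddCommGroup E] [InnerProductSpace ℂ E]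
    [NormedAddCommGroup F] [InnerProductSpace ℂ F] : Type _ :=
  UniformSpace.Completion (E ⊗[ℂ] F)

/-- The operator `T ⊗ I_F`, i.e. the continuous extension of `x ⊗ y ↦ T x ⊗ y`. -/
noncomputable def ampliation {E : Type*} (F : Type*) [NormedAddCommGroup E]
    [InnerProductSpace ℂ E] [NormedAddCommGroup F] [InnerProductSpace ℂ F]
    (T : E →L[ℂ] E) : HilbertTensor E F →L[ℂ] HilbertTensor E F :=
  ((UniformSpace.Completion.toComplL : E ⊗[ℂ] F →L[ℂ] HilbertTensor E F) ∘L
    T.rTensor F).extend UniformSpace.Completion.toComplL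

/-! ### The map `Φ_{f,A}` and the cone `C(f,A)⁺` -/

section PositiveMap

variable {ι : Type*} {H : Type*} [NormedAddCommGroup H] [InnerProductSpace ℂ H] [CompleteSpace H]

/-- The term `a_α A_α Y A_α^*`, as an element of `B(H)` with the weak operator topology. -/
noncomputable def phiTerm (a : FreeMonoid ι → ℝ) (A : ι → H →L[ℂ] H) (Y : H →L[ℂ] H)
    (α : FreeMonoid ι) : H →WOT[ℂ] H :=
  ContinuousLinearMapWOT.ofCLM
    ((a α : ℂ) • (wordOp A α * Y * ContinuousLinearMap.adjoint (wordOp A α)))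

/-- `Φ_{f,A}(Y) = ∑_{|α| ≥ 1} a_α A_α Y A_α^*`, the sum in the weak operator topology (the empty
word contributes nothing, as the constant coefficient of `f` is zero). -/
noncomputable def phi (a : FreeMonoid ι → ℝ) (A : ι → H →L[ℂ] H) (Y : H →L[ℂ] H) : H →L[ℂ] H :=
  (∑' α : FreeMonoid ι, phiTerm a A Y α).toCLM

/-- `D ∈ C(f,A)⁺`: `D ≥ 0` and `(id - Φ_{f,A})^s (D) ≥ 0` for `s = 1, …, m`. -/
def MemCone (a : FreeMonoid ι → ℝ) (m : ℕ) (A : ι → H →L[ℂ] H) (D : H →L[ℂ] H) : Prop :=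
  D.IsPositive ∧ ∀ s : ℕ, 1 ≤ s → s ≤ m → ((fun Y => Y - phi a A Y)^[s] D).IsPositive

end PositiveMap

end NCVariety

/-! A positive operator `T` is determined by its quadratic form `h ↦ ⟪T h, h⟫`, and on forms
`Φ_{f,A}` becomes `Ψ q (h) = ∑ a_α q (A_α^* h)`. With values in `[0, ∞]` every series of forms may
be rearranged freely. Write `U = ∑ Ψᵏ` for the potential. Then `Uᵐ q = ∑ₖ (k+m-1 choose m-1) Ψᵏ q`
(`psi_iterate_iterate_potential`), and expanding `Ψᵏ` over factorizations of words gives `Uᵐ q (h) =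
∑ b_α q (A_α^* h)` (`iterate_potential_eq_tsum_weight`).

All three conditions amount to one: there are positive `R` and `S ≥ c > 0` whose forms satisfy `q_S
= Uᵐ q_R`. For (iii) this is `hasSum_choose_smul_phi_iterate_iff`.

For (ii), let `D_s = (id - Φ)^s Q`. Purity lets `D_{s+1} = D_s - Φ(D_s)` telescope to `q_{D_s} = U
q_{D_{s+1}}`, so `q_Q = Uᵐ q_{D_m}`. Conversely, the forms `U^{m-s} q_R` come from positive
operators, which are the defects of `S`, and the forms of `Φᵏ(S)` are dominated by tails of a
convergent series.

For (i), factor `R = t^* t`. The Poisson kernel `K h = (√b_α t A_α^* h)_α` satisfies `‖K h‖² = ⟪S h,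
h⟫` and intertwines `A_i^*` with `W_i^* ⊗ I`. Since `p(A) = 0`, its range lies in `N_P ⊗ H`; since
`S ≥ c`, it is an isomorphism onto a closed subspace. Conversely, the intertwining relation forces a
similarity `Y` to have coordinates `√b_α E A_α^* h`, where `E` is its vacuum coordinate, so `q_{Y^*
Y} = Uᵐ q_{E^* E}`. -/

namespace NCVariety

/-! ### Rearrangement and telescoping of series in `[0, ∞]`. -/

section ENNRealSums

/-- Collect terms along `n = i + k`. -/
lemma tsum_tsum_mul_add (f g : ℕ → ℝ≥0∞) :
    ∑' k, f k * ∑' i, g (i + k) = ∑' n, (∑ k ∈ Finset.range (n + 1), f k) * g n := by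
  simp_rw [← ENNReal.tsum_mul_left]
  rw [← ENNReal.tsum_prod (f := fun k i => f k * g (i + k)),
    ← (Finset.HasAntidiagonal.sigmaAntidiagonalEquivProd (A := ℕ)).tsum_eq, ENNReal.tsum_sigma']
  refine tsum_congr fun n => ?_
  rw [tsum_fintype, Finset.sum_mul]
  simp only [Finset.HasAntidiagonal.sigmaAntidiagonalEquivProd_apply]
  rw [Finset.sum_coe_sort (Finset.HasAntidiagonal.antidiagonal n) (fun p : ℕ × ℕ => f p.1 * g (p.2 + p.1)),
    Finset.Nat.sum_antidiagonal_eq_sum_range_succ_mk]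
  refine Finset.sum_congr rfl fun k hk => ?_
  have : n - k + k = n := Nat.sub_add_cancel (Nat.lt_succ_iff.1 (Finset.mem_range.1 hk))
  simp [this]

/-- Iterated tails: if each sequence `x s` consists of the tails of `x (s + 1)`, then `x 0` is a
binomially weighted sum of `x s`. -/
lemma eq_tsum_choose_of_forall_eq_tail {m : ℕ} {x : ℕ → ℕ → ℝ≥0∞}
    (hx : ∀ s < m, ∀ j, x s j = ∑' k, x (s + 1) (k + j)) {s : ℕ} (hs : s < m) (j : ℕ) :
    x 0 j = ∑' k, ((k + s).choose s : ℝ≥0∞) * x (s + 1) (k + j) := by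
  induction s with
  | zero => simpa using hx 0 hs j
  | succ s ih =>
    rw [ih (by omega)]
    have h : ∀ k, x (s + 1) (k + j) = ∑' i, x (s + 2) (i + k + j) := fun k => by
      rw [hx (s + 1) hs]; simp [add_assoc]
    simp_rw [h]
    rw [tsum_tsum_mul_add (fun k => ((k + s).choose s : ℝ≥0∞)) (fun n => x (s + 2) (n + j))]
    refine tsum_congr fun n => ?_
    -- Hockey-stick identity: `∑_{k ≤ n} (k+s choose s) = (n+s+1 choose s+1)`.
    rw [← Nat.cast_sum, Nat.sum_range_add_choose, add_assoc]

/-- Telescoping, with the differences `d` given additively because subtraction in `[0, ∞]`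
truncates. -/
lemma tsum_eq_of_add_succ_eq {x d : ℕ → ℝ≥0∞} (h : ∀ k, d k + x (k + 1) = x k)
    (hx : Filter.Tendsto x Filter.atTop (nhds 0)) (j : ℕ) : ∑' k, d (k + j) = x j := by
  have hpart : ∀ n, ∑ i ∈ Finset.range n, d (i + j) + x (n + j) = x j := by
    intro n
    induction n with
    | zero => simp
    | succ n ih =>
      rw [Finset.sum_range_succ, add_assoc, show n + 1 + j = n + j + 1 by omega, h, ih]
  have h1 := (ENNReal.summable.hasSum (f := fun k => d (k + j))).tendsto_sum_nat.add
    (hx.comp (Filter.tendsto_add_atTop_nat j))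
  simp only [Function.comp_def, hpart, add_zero] at h1
  exact (tendsto_nhds_unique h1 tendsto_const_nhds)

end ENNRealSums

/-! ### Positive operators as quadratic forms, and weak operator sums. -/

section QuadraticForms

variable {κ : Type*} {H K : Type*} [NormedAddCommGroup H] [InnerProductSpace ℂ H]
  [NormedAddCommGroup K] [InnerProductSpace ℂ K]

/-- The quadratic form `h ↦ ⟪T h, h⟫` of a positive operator, with values in `[0, ∞]`. -/
noncomputable def qform (T : H →L[ℂ] H) (h : H) : ℝ≥0∞ := ENNReal.ofReal (T.reApplyInnerSelf h)

lemma qform_add {S T : H →L[ℂ] H} (hS : S.IsPositive) (hT : T.IsPositive) (h : H) :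
    qform (S + T) h = qform S h + qform T h := by
  rw [qform, qform, qform, ← ENNReal.ofReal_add (hS.2 h) (hT.2 h)]
  simp [ContinuousLinearMap.reApplyInnerSelf_apply, inner_add_left]

lemma qform_ne_top (T : H →L[ℂ] H) (h : H) : qform T h ≠ ⊤ := ENNReal.ofReal_ne_top

omit [InnerProductSpace ℂ H] in
lemma enorm_sq_eq_ofReal (h : H) : ‖h‖ₑ ^ 2 = ENNReal.ofReal (‖h‖ ^ 2) := by
  rw [ENNReal.ofReal_pow (norm_nonneg _), ofReal_norm]

omit [InnerProductSpace ℂ H] [InnerProductSpace ℂ K] in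
lemma norm_le_of_enorm_sq_le {C : NNReal} {x : K} {y : H} (h : ‖x‖ₑ ^ 2 ≤ C * ‖y‖ₑ ^ 2) :
    ‖x‖ ≤ √C * ‖y‖ := by
  rw [enorm_sq_eq_ofReal, enorm_sq_eq_ofReal, ← ENNReal.ofReal_coe_nnreal,
    ← ENNReal.ofReal_mul C.coe_nonneg, ENNReal.ofReal_le_ofReal_iff (by positivity)] at h
  rw [← Real.sqrt_sq (norm_nonneg x), ← Real.sqrt_sq (norm_nonneg y),
    ← Real.sqrt_mul C.coe_nonneg]
  exact Real.sqrt_le_sqrt h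

lemma qform_le (T : H →L[ℂ] H) (h : H) : qform T h ≤ ‖T‖ₑ * ‖h‖ₑ ^ 2 := by
  rw [enorm_sq_eq_ofReal, ← ofReal_norm, ← ENNReal.ofReal_mul (norm_nonneg _)]
  refine ENNReal.ofReal_le_ofReal ?_
  rw [ContinuousLinearMap.reApplyInnerSelf_apply]
  calc _ ≤ ‖⟪T h, h⟫_ℂ‖ := Complex.re_le_norm _
    _ ≤ ‖T h‖ * ‖h‖ := norm_inner_le_norm _ _
    _ ≤ ‖T‖ * ‖h‖ * ‖h‖ := by gcongr; exact T.le_opNorm h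
    _ = _ := by ring

/-- Complex polarization; positivity ensures that `ENNReal.ofReal` loses no information. -/
lemma eq_of_qform_eq {S T : H →L[ℂ] H} (hS : S.IsPositive) (hT : T.IsPositive)
    (h : qform S = qform T) : S = T := by
  have hre : ∀ x, S.reApplyInnerSelf x = T.reApplyInnerSelf x := fun x =>
    (ENNReal.ofReal_eq_ofReal_iff (hS.2 x) (hT.2 x)).1 (congrFun h x)
  refine ContinuousLinearMap.coe_inj.1 (LinearMap.ext fun _ => ?_)
  revert ‹H›
  refine LinearMap.ext_iff.1 ?_
  rw [← ext_inner_map]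
  intro x
  have h1 := (hS.isSymmetric.coe_reApplyInnerSelf_apply x)
  have h2 := (hT.isSymmetric.coe_reApplyInnerSelf_apply x)
  rw [hre x] at h1
  exact h1.symm.trans h2

variable [CompleteSpace H] [CompleteSpace K]

lemma qform_adjoint_comp_self (V : H →L[ℂ] K) (h : H) :
    qform (ContinuousLinearMap.adjoint V ∘L V) h = ‖V h‖ₑ ^ 2 := by
  rw [qform, enorm_sq_eq_ofReal, ContinuousLinearMap.reApplyInnerSelf_apply,
    ContinuousLinearMap.comp_apply, ContinuousLinearMap.adjoint_inner_left,
    inner_self_eq_norm_sq (𝕜 := ℂ)]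

lemma exists_eq_adjoint_comp_self {T : H →L[ℂ] H} (hT : T.IsPositive) :
    ∃ t : H →L[ℂ] H, T = ContinuousLinearMap.adjoint t ∘L t :=
  CStarAlgebra.nonneg_iff_eq_star_mul_self.1 ((ContinuousLinearMap.nonneg_iff_isPositive T).2 hT)

/-- With `T = t^* t` one has `‖t^* t h‖² ≤ ‖t‖² ‖t h‖²`. For uniformly bounded positive operators
this turns convergence of forms to zero into strong convergence. -/
lemma enorm_sq_le_of_qform_le {T : H →L[ℂ] H} (hT : T.IsPositive) {C : NNReal}
    (hC : ∀ h, qform T h ≤ C * ‖h‖ₑ ^ 2) (h : H) : ‖T h‖ₑ ^ 2 ≤ C * qform T h := by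
  obtain ⟨t, rfl⟩ := exists_eq_adjoint_comp_self hT
  simp only [qform_adjoint_comp_self] at hC ⊢
  have ht : ‖t‖ₑ ^ 2 ≤ C := by
    have : ‖t‖ ≤ √(C : ℝ) := t.opNorm_le_bound (Real.sqrt_nonneg _) fun x =>
      norm_le_of_enorm_sq_le (hC x)
    rw [← ENNReal.ofReal_coe_nnreal, ← ofReal_norm, ← ENNReal.ofReal_pow (norm_nonneg _)]
    refine ENNReal.ofReal_le_ofReal ?_
    calc ‖t‖ ^ 2 ≤ √(C : ℝ) ^ 2 := by gcongr
      _ = (C : ℝ) := Real.sq_sqrt C.coe_nonneg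
  calc ‖ContinuousLinearMap.adjoint t (t h)‖ₑ ^ 2
      ≤ (‖ContinuousLinearMap.adjoint t‖ₑ * ‖t h‖ₑ) ^ 2 := by
        gcongr; exact ContinuousLinearMap.le_opENorm _ _
    _ = ‖t‖ₑ ^ 2 * ‖t h‖ₑ ^ 2 := by
        rw [mul_pow, ← ofReal_norm, LinearIsometryEquiv.norm_map, ofReal_norm]
    _ ≤ _ := by gcongr

omit [InnerProductSpace ℂ K] [CompleteSpace K] in
lemma enorm_sq_eq_tsum (z : lp (fun _ : κ => K) 2) : ‖z‖ₑ ^ 2 = ∑' k, ‖z k‖ₑ ^ 2 := by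
  have h := lp.norm_rpow_eq_tsum (p := 2) (by norm_num) z
  simp only [ENNReal.toReal_ofNat, Real.rpow_ofNat] at h
  have hs : Summable fun k => ‖z k‖ ^ 2 := by
    simpa using (lp.memℓp z).summable (p := 2) (by norm_num)
  rw [enorm_sq_eq_ofReal, h, ENNReal.ofReal_tsum_of_nonneg (fun _ => by positivity) hs]
  simp_rw [enorm_sq_eq_ofReal]

omit [CompleteSpace H] [CompleteSpace K] in
/-- A square summable column of operators is a bounded operator into a Hilbert sum. -/
lemma exists_column (T : κ → H →L[ℂ] K) (C : NNReal)
    (hT : ∀ h, ∑' k, ‖T k h‖ₑ ^ 2 ≤ C * ‖h‖ₑ ^ 2) :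
    ∃ V : H →L[ℂ] lp (fun _ : κ => K) 2, ∀ h k, V h k = T k h := by
  have hmem : ∀ h, Memℓp (fun k => T k h) 2 := fun h => by
    refine memℓp_gen ?_
    have hfin : ∑' k, ‖T k h‖ₑ ^ 2 ≠ ⊤ := ne_top_of_le_ne_top (by finiteness) (hT h)
    simpa [Real.rpow_ofNat] using (ENNReal.summable_toReal hfin)
  let V : H →ₗ[ℂ] lp (fun _ : κ => K) 2 :=
    { toFun := fun h => ⟨fun k => T k h, hmem h⟩
      map_add' := fun x y => lp.ext (funext fun k => map_add (T k) x y)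
      map_smul' := fun c x => lp.ext (funext fun k => map_smul (T k) c x) }
  exact ⟨V.mkContinuous √C fun h =>
    norm_le_of_enorm_sq_le ((enorm_sq_eq_tsum (V h)).trans_le (hT h)), fun h k => rfl⟩

omit [CompleteSpace K] in
lemma hasSum_wot_iff {f : κ → H →WOT[ℂ] H} {T : H →WOT[ℂ] H} :
    HasSum f T ↔ ∀ x y, HasSum (fun k => ⟪y, f k x⟫_ℂ) ⟪y, T x⟫_ℂ := by
  have happ : ∀ (s : Finset κ) x, (∑ k ∈ s, f k) x = ∑ k ∈ s, f k x := fun s x => by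
    induction s using Finset.cons_induction with
    | empty => simp
    | cons k s hk ih => simp [Finset.sum_cons, ih]
  rw [HasSum, ContinuousLinearMapWOT.tendsto_iff_forall_inner_apply_tendsto]
  simp only [HasSum, happ, inner_sum]

/-- A family of positive operators whose quadratic forms have a bounded sum is summable in the weak
operator topology. -/
lemma exists_hasSum_wot {T : κ → H →L[ℂ] H} (hT : ∀ k, (T k).IsPositive) {C : NNReal}
    (hC : ∀ h, ∑' k, qform (T k) h ≤ C * ‖h‖ₑ ^ 2) :
    ∃ G : H →L[ℂ] H, G.IsPositive ∧ (∀ h, qform G h = ∑' k, qform (T k) h) ∧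
      HasSum (fun k => ContinuousLinearMapWOT.ofCLM (T k)) (ContinuousLinearMapWOT.ofCLM G) := by
  choose t ht using fun k => exists_eq_adjoint_comp_self (hT k)
  have hq : ∀ k h, qform (T k) h = ‖t k h‖ₑ ^ 2 := fun k h => by
    rw [ht k, qform_adjoint_comp_self]
  simp_rw [hq] at hC
  -- For the column `V = (t_k)` with `T_k = t_k^* t_k`, the operator `V^* V` is the required sum.
  obtain ⟨V, hV⟩ := exists_column t C hC
  refine ⟨ContinuousLinearMap.adjoint V ∘L V, ContinuousLinearMap.isPositive_adjoint_comp_self V,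
    fun h => ?_, hasSum_wot_iff.2 fun x y => ?_⟩
  · rw [qform_adjoint_comp_self, enorm_sq_eq_tsum]
    simp_rw [hV, hq]
  · have h := lp.hasSum_inner (𝕜 := ℂ) (V y) (V x)
    simp only [ContinuousLinearMapWOT.ofCLM_apply, ContinuousLinearMap.comp_apply,
      ContinuousLinearMap.adjoint_inner_right]
    refine h.congr_fun fun k => ?_
    rw [hV, hV, ht k, ContinuousLinearMap.comp_apply, ContinuousLinearMap.adjoint_inner_right]

/-- Together with `HasSum.qform_eq`, this trades weak convergence of a positive series for an
identity of forms. -/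
lemma hasSum_wot_of_qform {T : κ → H →L[ℂ] H} (hT : ∀ k, (T k).IsPositive) {S : H →L[ℂ] H}
    (hS : S.IsPositive) (h : ∀ h, ∑' k, qform (T k) h = qform S h) :
    HasSum (fun k => ContinuousLinearMapWOT.ofCLM (T k)) (ContinuousLinearMapWOT.ofCLM S) := by
  obtain ⟨G, hG, hGq, hsum⟩ := exists_hasSum_wot hT (C := ‖S‖₊)
    fun x => (h x).trans_le (qform_le S x)
  rwa [eq_of_qform_eq hS hG (funext fun x => (h x).symm.trans (hGq x).symm)]

lemma HasSum.qform_eq {T : κ → H →L[ℂ] H} (hT : ∀ k, (T k).IsPositive) {S : H →L[ℂ] H}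
    (h : HasSum (fun k => ContinuousLinearMapWOT.ofCLM (T k)) (ContinuousLinearMapWOT.ofCLM S))
    (x : H) : qform S x = ∑' k, qform (T k) x := by
  have h1 : HasSum (fun k => (T k).reApplyInnerSelf x) (S.reApplyInnerSelf x) := by
    have := (hasSum_wot_iff.1 h x x).mapL Complex.reCLM
    simp only [ContinuousLinearMapWOT.ofCLM_apply, Complex.reCLM_apply] at this
    convert this using 1
    · ext k
      rw [ContinuousLinearMap.reApplyInnerSelf_apply, inner_re_symm]; rfl
    · rw [ContinuousLinearMap.reApplyInnerSelf_apply, inner_re_symm]; rfl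
  rw [qform, ← h1.tsum_eq, ENNReal.ofReal_tsum_of_nonneg (fun k => (hT k).2 x) h1.summable]
  rfl

end QuadraticForms

/-! ### The map `Φ_{f,A}` on forms and its potential. -/

section Phi

variable {ι : Type*} {H : Type*} [NormedAddCommGroup H] [InnerProductSpace ℂ H] [CompleteSpace H]

/-- The action of `Φ_{f,A}` on quadratic forms. -/
noncomputable def psi (a : FreeMonoid ι → ℝ) (A : ι → H →L[ℂ] H) (q : H → ℝ≥0∞) (h : H) : ℝ≥0∞ :=
  ∑' α, ENNReal.ofReal (a α) * q (ContinuousLinearMap.adjoint (wordOp A α) h)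

variable {a : FreeMonoid ι → ℝ} {A : ι → H →L[ℂ] H}

lemma psi_add (q r : H → ℝ≥0∞) : psi a A (q + r) = psi a A q + psi a A r := by
  ext h
  simp [psi, mul_add, ENNReal.tsum_add]

lemma psi_iterate_add (k : ℕ) (q r : H → ℝ≥0∞) :
    (psi a A)^[k] (q + r) = (psi a A)^[k] q + (psi a A)^[k] r := by
  induction k generalizing q r with
  | zero => rfl
  | succ k ih => simp only [Function.iterate_succ_apply, psi_add, ih]

lemma psi_tsum (q : ℕ → H → ℝ≥0∞) :
    psi a A (fun h => ∑' k, q k h) = fun h => ∑' k, psi a A (q k) h := by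
  ext h
  simp only [psi, ← ENNReal.tsum_mul_left]
  exact ENNReal.tsum_comm

lemma psi_iterate_tsum (j : ℕ) (q : ℕ → H → ℝ≥0∞) :
    (psi a A)^[j] (fun h => ∑' k, q k h) = fun h => ∑' k, (psi a A)^[j] (q k) h := by
  induction j generalizing q with
  | zero => rfl
  | succ j ih => simp only [Function.iterate_succ_apply, psi_tsum, ih]

/-- The potential `∑ₖ Ψᵏ q` of a quadratic form. -/
noncomputable def potential (a : FreeMonoid ι → ℝ) (A : ι → H →L[ℂ] H) (q : H → ℝ≥0∞) (h : H) :
    ℝ≥0∞ :=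
  ∑' k : ℕ, (psi a A)^[k] q h

/-- The resolvent identity `U = id + Ψ U`, from splitting off the term `k = 0`. -/
lemma add_psi_potential (q : H → ℝ≥0∞) :
    q + psi a A (potential a A q) = potential a A q := by
  ext h
  rw [Pi.add_apply, potential, tsum_eq_zero_add' ENNReal.summable]
  simp only [Function.iterate_succ_apply']
  exact congrArg (q h + ·) (congrFun (psi_tsum _) h)

lemma le_potential (q : H → ℝ≥0∞) : q ≤ potential a A q := by
  conv_rhs => rw [← add_psi_potential]
  exact le_self_add

lemma psi_iterate_potential (j : ℕ) (q : H → ℝ≥0∞) (h : H) :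
    (psi a A)^[j] (potential a A q) h = ∑' k, (psi a A)^[k + j] q h := by
  have := congrFun (psi_iterate_tsum (a := a) (A := A) j fun k => (psi a A)^[k] q) h
  refine this.trans (tsum_congr fun k => ?_)
  rw [add_comm, Function.iterate_add_apply]

/-- The coefficients are those of `(1 - t)^{-(m+1)}`, as `U` is the Neumann series of `(1 -
Ψ)^{-1}`. -/
lemma psi_iterate_iterate_potential (m j : ℕ) (q : H → ℝ≥0∞) (h : H) :
    (psi a A)^[j] ((potential a A)^[m + 1] q) h =
      ∑' k : ℕ, ((k + m).choose m : ℝ≥0∞) * (psi a A)^[k + j] q h := by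
  -- The sequence `x s` lists `Ψʲ U^{m+1-s} q`; one potential fewer means passing from tails to
  -- terms.
  have key := eq_tsum_choose_of_forall_eq_tail (m := m + 1)
    (x := fun s j => (psi a A)^[j] ((potential a A)^[m + 1 - s] q) h) (fun s hs j => by
      rw [show m + 1 - s = m + 1 - (s + 1) + 1 by omega, Function.iterate_succ_apply',
        psi_iterate_potential]) (Nat.lt_succ_self m) j
  simpa using key

lemma phiTerm_isPositive (ha : ∀ α, 0 ≤ a α) {Y : H →L[ℂ] H} (hY : Y.IsPositive)
    (α : FreeMonoid ι) : (phiTerm a A Y α).toCLM.IsPositive :=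
  (hY.conj_adjoint (wordOp A α)).smul_of_nonneg (by exact_mod_cast ha α)

lemma qform_phiTerm (ha : ∀ α, 0 ≤ a α) (Y : H →L[ℂ] H) (α : FreeMonoid ι) (h : H) :
    qform (phiTerm a A Y α).toCLM h =
      ENNReal.ofReal (a α) * qform Y (ContinuousLinearMap.adjoint (wordOp A α) h) := by
  rw [qform, qform, ← ENNReal.ofReal_mul (ha α), ContinuousLinearMap.reApplyInnerSelf_apply,
    ContinuousLinearMap.reApplyInnerSelf_apply, ContinuousLinearMap.adjoint_inner_right]
  change ENNReal.ofReal (RCLike.re ⟪(a α : ℂ) • (wordOp A α) (Y _), h⟫_ℂ) = _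
  rw [inner_smul_left, Complex.conj_ofReal]
  congr 1
  exact Complex.re_ofReal_mul _ _

/-- Since `q_Y ≤ ‖Y‖ q_1`, convergence of `Φ(1)` controls `Φ(Y)` for every `Y`. -/
lemma psi_qform_le (ha : ∀ α, 0 ≤ a α) (hA : Summable (phiTerm a A 1)) (Y : H →L[ℂ] H) (h : H) :
    psi a A (qform Y) h ≤ ↑(‖Y‖₊ * ‖phi a A 1‖₊) * ‖h‖ₑ ^ 2 := by
  have hone : psi a A (qform 1) h = qform (phi a A 1) h := by
    rw [HasSum.qform_eq (S := phi a A 1) (phiTerm_isPositive ha ContinuousLinearMap.isPositive_one)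
      hA.hasSum h]
    exact tsum_congr fun α => (qform_phiTerm ha 1 α h).symm
  have hY : ∀ x, qform Y x ≤ ‖Y‖₊ * qform 1 x := fun x => by
    refine (qform_le Y x).trans (le_of_eq ?_)
    rw [qform, ContinuousLinearMap.reApplyInnerSelf_apply, show (1 : H →L[ℂ] H) x = x from rfl,
      inner_self_eq_norm_sq (𝕜 := ℂ), ← enorm_sq_eq_ofReal]
    rfl
  calc psi a A (qform Y) h ≤ ‖Y‖₊ * psi a A (qform 1) h := by
        rw [psi, psi, ← ENNReal.tsum_mul_left]
        refine ENNReal.tsum_le_tsum fun α => ?_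
        rw [mul_left_comm]
        gcongr
        exact hY _
    _ ≤ ‖Y‖₊ * (‖phi a A 1‖₊ * ‖h‖ₑ ^ 2) := by
        rw [hone]; gcongr; exact qform_le _ _
    _ = _ := by push_cast; ring

/-- The bound `psi_qform_le` gives summability, so the `tsum` defining `phi` is a true sum and not
the default value `0`. -/
lemma phi_isPositive_and_qform (ha : ∀ α, 0 ≤ a α) (hA : Summable (phiTerm a A 1))
    {Y : H →L[ℂ] H} (hY : Y.IsPositive) :
    (phi a A Y).IsPositive ∧ qform (phi a A Y) = psi a A (qform Y) := by
  have hq : ∀ h, ∑' α, qform (phiTerm a A Y α).toCLM h = psi a A (qform Y) h := fun h =>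
    tsum_congr fun α => qform_phiTerm ha Y α h
  obtain ⟨G, hG, hGq, hsum⟩ := exists_hasSum_wot (phiTerm_isPositive (A := A) ha hY)
    (fun h => (hq h).trans_le (psi_qform_le ha hA Y h))
  have : phi a A Y = G := congrArg ContinuousLinearMapWOT.toCLM hsum.tsum_eq
  exact this ▸ ⟨hG, funext fun h => (hGq h).trans (hq h)⟩

lemma phi_iterate_isPositive_and_qform (ha : ∀ α, 0 ≤ a α) (hA : Summable (phiTerm a A 1))
    {Y : H →L[ℂ] H} (hY : Y.IsPositive) (k : ℕ) :
    ((phi a A)^[k] Y).IsPositive ∧ qform ((phi a A)^[k] Y) = (psi a A)^[k] (qform Y) := by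
  induction k with
  | zero => exact ⟨hY, rfl⟩
  | succ k ih =>
    rw [Function.iterate_succ_apply', Function.iterate_succ_apply', ← ih.2]
    exact phi_isPositive_and_qform ha hA ih.1

end Phi

/-! ### Binomial series, the cone and purity in terms of potentials. -/

section BinomialSeries

variable {ι : Type*} {H : Type*} [NormedAddCommGroup H] [InnerProductSpace ℂ H] [CompleteSpace H]
  {a : FreeMonoid ι → ℝ} {A : ι → H →L[ℂ] H}

/-- The binomial series `∑ₖ (k + m choose m) Φᵏ(R)` converges weakly to `S` if and only if its
quadratic form is an iterated potential. -/
lemma hasSum_choose_smul_phi_iterate_iff (ha : ∀ α, 0 ≤ a α) (hA : Summable (phiTerm a A 1))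
    {R S : H →L[ℂ] H} (hR : R.IsPositive) (hS : S.IsPositive) (m : ℕ) :
    HasSum (fun k : ℕ => ContinuousLinearMapWOT.ofCLM
      (((k + m).choose m : ℂ) • ((phi a A)^[k] R))) (ContinuousLinearMapWOT.ofCLM S) ↔
      qform S = (potential a A)^[m + 1] (qform R) := by
  have hpos : ∀ k : ℕ, (((k + m).choose m : ℂ) • ((phi a A)^[k] R)).IsPositive := fun k =>
    (phi_iterate_isPositive_and_qform ha hA hR k).1.smul_of_nonneg
      (open scoped ComplexOrder in Nat.cast_nonneg _)
  have hq : ∀ h, ∑' k : ℕ, qform (((k + m).choose m : ℂ) • ((phi a A)^[k] R)) h =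
      (potential a A)^[m + 1] (qform R) h := fun h => by
    refine Eq.trans ?_ (psi_iterate_iterate_potential m 0 (qform R) h).symm
    refine tsum_congr fun k => ?_
    rw [add_zero, ← (phi_iterate_isPositive_and_qform ha hA hR k).2, qform, qform,
      ← ENNReal.ofReal_natCast, ← ENNReal.ofReal_mul (Nat.cast_nonneg _),
      ContinuousLinearMap.reApplyInnerSelf_apply, ContinuousLinearMap.reApplyInnerSelf_apply,
      smul_apply, inner_smul_left, ← Complex.ofReal_natCast,
      Complex.conj_ofReal]
    congr 1
    exact Complex.re_ofReal_mul _ _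
  constructor
  · intro h
    exact funext fun x => (HasSum.qform_eq hpos h x).trans (hq x)
  · intro h
    exact hasSum_wot_of_qform hpos hS fun x => (hq x).trans (congrFun h x).symm

/-- A pure element of the cone is the iterated potential of its last defect. -/
lemma qform_eq_potential_of_memCone (ha : ∀ α, 0 ≤ a α) (hA : Summable (phiTerm a A 1)) {m : ℕ}
    {Q : H →L[ℂ] H} (hQ : MemCone a (m + 1) A Q)
    (hlim : ∀ h, Filter.Tendsto (fun k : ℕ => ((phi a A)^[k] Q) h) Filter.atTop (nhds 0)) :
    qform Q = (potential a A)^[m + 1] (qform ((fun Y => Y - phi a A Y)^[m + 1] Q)) := by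
  set D : ℕ → H →L[ℂ] H := fun s => (fun Y => Y - phi a A Y)^[s] Q with hD
  have hpos : ∀ s ≤ m + 1, (D s).IsPositive := fun s hs => by
    rcases Nat.eq_zero_or_pos s with rfl | h
    · exact hQ.1
    · exact hQ.2 s h hs
  -- This is `D_{s+1} = D_s - Φ(D_s)`, written without subtraction.
  have hadd : ∀ s < m + 1, qform (D (s + 1)) + psi a A (qform (D s)) = qform (D s) := fun s hs => by
    have h1 := phi_isPositive_and_qform ha hA (hpos s hs.le)
    rw [← h1.2]
    ext h
    rw [Pi.add_apply, ← qform_add (hpos (s + 1) hs) h1.1]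
    congr 1
    simp only [hD, Function.iterate_succ_apply']
    exact sub_add_cancel _ _
  have hstep : ∀ s < m + 1, ∀ k h, (psi a A)^[k] (qform (D (s + 1))) h +
      (psi a A)^[k + 1] (qform (D s)) h = (psi a A)^[k] (qform (D s)) h := fun s hs k h => by
    rw [Function.iterate_succ_apply, ← Pi.add_apply, ← psi_iterate_add, hadd s hs]
  -- Purity descends from `Q` to each defect because `D_{s+1} ≤ D_s`.
  have hzero : ∀ s ≤ m + 1, ∀ h,
      Filter.Tendsto (fun k => (psi a A)^[k] (qform (D s)) h) Filter.atTop (nhds 0) := by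
    intro s
    induction s with
    | zero =>
      intro _ h
      have hre : Filter.Tendsto (fun k => ((phi a A)^[k] Q).reApplyInnerSelf h)
          Filter.atTop (nhds 0) := by
        have := (Complex.continuous_re.tendsto _).comp ((hlim h).inner tendsto_const_nhds (y := h))
        simpa [Function.comp_def, ContinuousLinearMap.reApplyInnerSelf_apply] using this
      have := ENNReal.tendsto_ofReal hre
      rw [ENNReal.ofReal_zero] at this
      refine this.congr fun k => ?_
      exact congrFun (phi_iterate_isPositive_and_qform ha hA hQ.1 k).2 h
    | succ s ih =>
      intro hs h
      refine tendsto_of_tendsto_of_tendsto_of_le_of_le tendsto_const_nhds (ih (by omega) h)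
        (fun _ => zero_le) fun k => ?_
      exact le_self_add.trans (hstep s hs k h).le
  have hpot : ∀ s < m + 1, qform (D s) = potential a A (qform (D (s + 1))) := fun s hs => by
    ext h
    exact (tsum_eq_of_add_succ_eq (fun k => hstep s hs k h) (hzero s hs.le h) 0).symm
  have hall : ∀ s ≤ m + 1, qform Q = (potential a A)^[s] (qform (D s)) := by
    intro s
    induction s with
    | zero => intro _; rfl
    | succ s ih =>
      intro hs
      rw [Function.iterate_succ_apply, ← hpot s hs, ih (by omega)]
  exact hall _ le_rfl

lemma le_iterate_potential (q : H → ℝ≥0∞) {s t : ℕ} (hst : s ≤ t) :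
    (potential a A)^[s] q ≤ (potential a A)^[t] q := by
  induction t, hst using Nat.le_induction with
  | base => exact le_rfl
  | succ t _ ih =>
    rw [Function.iterate_succ_apply']
    exact ih.trans (le_potential _)

/-- Potentials only increase a form, so `Uˢ q_R ≤ q_S` for `s ≤ m`; this bound makes the lower
potentials forms of bounded operators. -/
lemma exists_qform_eq_iterate_potential (ha : ∀ α, 0 ≤ a α) (hA : Summable (phiTerm a A 1))
    {m : ℕ} {R S : H →L[ℂ] H} (hR : R.IsPositive)
    (hS : qform S = (potential a A)^[m] (qform R)) {s : ℕ} (hs : s ≤ m) :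
    ∃ G : H →L[ℂ] H, G.IsPositive ∧ qform G = (potential a A)^[s] (qform R) := by
  induction s with
  | zero => exact ⟨R, hR, rfl⟩
  | succ s ih =>
    obtain ⟨G, hG, hGq⟩ := ih (by omega)
    have hsum : ∀ h, ∑' k, qform ((phi a A)^[k] G) h = (potential a A)^[s + 1] (qform R) h := by
      intro h
      rw [Function.iterate_succ_apply', ← hGq]
      exact tsum_congr fun k => congrFun (phi_iterate_isPositive_and_qform ha hA hG k).2 h
    obtain ⟨G', hG', hGq', -⟩ := exists_hasSum_wot (C := ‖S‖₊)
      (fun k => (phi_iterate_isPositive_and_qform ha hA hG k).1) (fun h => by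
        rw [hsum h]
        refine (le_iterate_potential _ hs h).trans ?_
        rw [← hS]
        exact qform_le S h)
    exact ⟨G', hG', funext fun h => (hGq' h).trans (hsum h)⟩

/-- By the resolvent identity, each application of `id - Φ` removes one potential, so the `s`-th
defect of `S` has form `U^{m-s} q_R`. -/
lemma memCone_of_qform_eq_potential (ha : ∀ α, 0 ≤ a α) (hA : Summable (phiTerm a A 1))
    {m : ℕ} {R S : H →L[ℂ] H} (hR : R.IsPositive) (hS : S.IsPositive)
    (hSq : qform S = (potential a A)^[m] (qform R)) : MemCone a m A S := by
  have key : ∀ s ≤ m, ((fun Y => Y - phi a A Y)^[s] S).IsPositive ∧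
      qform ((fun Y => Y - phi a A Y)^[s] S) = (potential a A)^[m - s] (qform R) := by
    intro s
    induction s with
    | zero => exact fun _ => ⟨hS, hSq⟩
    | succ s ih =>
      intro hs
      obtain ⟨hD, hDq⟩ := ih (by omega)
      obtain ⟨G, hG, hGq⟩ := exists_qform_eq_iterate_potential ha hA hR hSq
        (s := m - (s + 1)) (by omega)
      have hphi := phi_isPositive_and_qform ha hA hD
      suffices h : (fun Y => Y - phi a A Y)^[s + 1] S = G from h ▸ ⟨hG, hGq⟩
      rw [Function.iterate_succ_apply', sub_eq_iff_eq_add]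
      refine eq_of_qform_eq hD (hG.add hphi.1) (funext fun h => ?_)
      rw [qform_add hG hphi.1, hphi.2, hGq, hDq, ← Pi.add_apply,
        show m - s = m - (s + 1) + 1 by omega, Function.iterate_succ_apply', add_psi_potential]
  exact ⟨hS, fun s _ hs => (key s hs).1⟩

/-- As `(k+m choose m) ≤ (k+j+m choose m)`, the form of `Φʲ(S)` is at most the `j`-th tail of the
convergent series for `q_S`; `enorm_sq_le_of_qform_le` then gives strong convergence. -/
lemma tendsto_phi_iterate_of_qform_eq_potential (ha : ∀ α, 0 ≤ a α)
    (hA : Summable (phiTerm a A 1)) {m : ℕ} {R S : H →L[ℂ] H} (hS : S.IsPositive)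
    (hSq : qform S = (potential a A)^[m + 1] (qform R)) (h : H) :
    Filter.Tendsto (fun k : ℕ => ((phi a A)^[k] S) h) Filter.atTop (nhds 0) := by
  have hle : ∀ j x, qform ((phi a A)^[j] S) x ≤
      ∑' k : ℕ, ((k + j + m).choose m : ℝ≥0∞) * (psi a A)^[k + j] (qform R) x := fun j x => by
    rw [(phi_iterate_isPositive_and_qform ha hA hS j).2, hSq, psi_iterate_iterate_potential]
    refine ENNReal.tsum_le_tsum fun k => ?_
    gcongr
    omega
  have htsum : ∀ x, ∑' k : ℕ, ((k + m).choose m : ℝ≥0∞) * (psi a A)^[k] (qform R) x =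
      qform S x := fun x => by
    rw [hSq]; exact (psi_iterate_iterate_potential m 0 (qform R) x).symm
  have htail : ∀ x, Filter.Tendsto (fun j => qform ((phi a A)^[j] S) x) Filter.atTop (nhds 0) :=
    fun x => tendsto_of_tendsto_of_tendsto_of_le_of_le tendsto_const_nhds
      (ENNReal.tendsto_sum_nat_add
        (fun k : ℕ => ((k + m).choose m : ℝ≥0∞) * (psi a A)^[k] (qform R) x)
        (by rw [htsum]; exact qform_ne_top S x))
      (fun _ => zero_le) (fun j => hle j x)
  have hbound : ∀ j x, qform ((phi a A)^[j] S) x ≤ ‖S‖₊ * ‖x‖ₑ ^ 2 := fun j x => by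
    refine ((hle j x).trans ?_).trans (qform_le S x)
    rw [← htsum]
    exact ENNReal.tsum_comp_le_tsum_of_injective (add_left_injective j)
      (fun k : ℕ => ((k + m).choose m : ℝ≥0∞) * (psi a A)^[k] (qform R) x)
  have hsq : Filter.Tendsto (fun j => ‖((phi a A)^[j] S) h‖ₑ ^ 2) Filter.atTop (nhds 0) := by
    refine tendsto_of_tendsto_of_tendsto_of_le_of_le tendsto_const_nhds ?_ (fun _ => zero_le)
      fun j => enorm_sq_le_of_qform_le (phi_iterate_isPositive_and_qform ha hA hS j).1 (hbound j) h
    simpa using ENNReal.Tendsto.const_mul (htail h) (Or.inr ENNReal.coe_ne_top)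
  have := (ENNReal.tendsto_toReal ENNReal.zero_ne_top).comp hsq
  rw [tendsto_zero_iff_norm_tendsto_zero]
  have h2 := (Real.continuous_sqrt.tendsto _).comp this
  simpa [Function.comp_def, Real.sqrt_sq] using h2

end BinomialSeries

/-! ### The weights `b_α` as coefficients of the iterated potential. -/

section WeightedSums

variable {ι : Type*} {a : FreeMonoid ι → ℝ}

-- Factors may be allowed to be empty: such a factor contributes `a_1 = 0`.
open Classical in
lemma ofReal_factorSum (ha : PositiveRegular a) (k : ℕ) (α : FreeMonoid ι) :
    ENNReal.ofReal (∑ᶠ L ∈ factorizations k α, (L.map a).prod) =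
      ∑' L : List (FreeMonoid ι), if L.length = k ∧ L.prod = α then
        (L.map fun γ => ENNReal.ofReal (a γ)).prod else 0 := by
  have hprod : ∀ L : List (FreeMonoid ι), ENNReal.ofReal (L.map a).prod =
      (L.map fun γ => ENNReal.ofReal (a γ)).prod := fun L => by
    induction L with
    | nil => simp
    | cons γ L ih => simp [ENNReal.ofReal_mul (ha.nonneg γ), ih]
  have hnn : ∀ L : List (FreeMonoid ι), 0 ≤ (L.map a).prod := fun L => by
    refine List.prod_nonneg ?_
    simp only [List.mem_map, forall_exists_index, and_imp]
    rintro _ γ - rfl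
    exact ha.nonneg γ
  rw [finsum_mem_eq_finite_toFinset_sum _ (factorizations_finite k α),
    ENNReal.ofReal_sum_of_nonneg fun L _ => hnn L, tsum_eq_sum
      (s := (factorizations_finite k α).toFinset)]
  · refine Finset.sum_congr rfl fun L hL => ?_
    rw [Set.Finite.mem_toFinset] at hL
    rw [if_pos ⟨hL.1, hL.2.2⟩, hprod]
  · intro L hL
    rw [Set.Finite.mem_toFinset] at hL
    split_ifs with h
    · have : ∃ γ ∈ L, ¬ 1 ≤ γ.length := by
        by_contra! hcon
        exact hL ⟨h.1, hcon, h.2⟩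
      obtain ⟨γ, hγ, hlen⟩ := this
      have hγ1 : γ = 1 := FreeMonoid.length_eq_zero.1 (by omega)
      refine List.prod_eq_zero (List.mem_map.2 ⟨γ, hγ, ?_⟩)
      rw [hγ1, ha.coeff_one, ENNReal.ofReal_zero]
    · rfl

/-- The range `1 ≤ k ≤ |α|` extends to all `k`: there are no factorizations into more than `|α|`
nonempty words, and `k = 0` occurs only for the empty word, where it yields `b_1 = 1`. -/
lemma ofReal_weight (ha : PositiveRegular a) (m : ℕ) (α : FreeMonoid ι) :
    ENNReal.ofReal (weight a (m + 1) α) = ∑' k : ℕ, ((k + m).choose m : ℝ≥0∞) *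
      ENNReal.ofReal (∑ᶠ L ∈ factorizations k α, (L.map a).prod) := by
  have hempty : ∀ k, α.length < k → factorizations k α = ∅ := fun k hk => by
    refine Set.eq_empty_of_forall_notMem fun L hL => ?_
    have hlen : ∀ L : List (FreeMonoid ι), (∀ γ ∈ L, 1 ≤ γ.length) →
        L.length ≤ L.prod.length := fun L => by
      induction L with
      | nil => simp
      | cons γ L ih =>
        intro h
        have h1 := h γ List.mem_cons_self
        have h2 := ih fun δ hδ => h δ (List.mem_cons_of_mem _ hδ)
        rw [List.prod_cons, FreeMonoid.length_mul, List.length_cons]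
        omega
    have := hlen L hL.2.1
    rw [hL.1, hL.2.2] at this
    omega
  by_cases h0 : α.length = 0
  · obtain rfl : α = 1 := FreeMonoid.length_eq_zero.1 h0
    rw [tsum_eq_single 0 fun k hk => by rw [hempty k (by simpa using Nat.pos_of_ne_zero hk)]; simp]
    have : factorizations 0 (1 : FreeMonoid ι) = {[]} := by
      ext L
      constructor
      · rintro ⟨h, -, -⟩
        simpa using h
      · rintro rfl
        exact ⟨rfl, by simp, rfl⟩
    rw [this, finsum_mem_singleton]
    simp [weight]
  · have hzero : factorizations 0 α = ∅ := by
      refine Set.eq_empty_of_forall_notMem fun L hL => h0 ?_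
      have hL0 := List.length_eq_zero_iff.1 hL.1
      rw [← hL.2.2, hL0]
      simp
    rw [weight, if_neg h0, ENNReal.ofReal_sum_of_nonneg fun j _ =>
      mul_nonneg (factorSum_nonneg ha j α) (Nat.cast_nonneg _),
      tsum_eq_sum (s := Finset.Icc 1 α.length)]
    · refine Finset.sum_congr rfl fun j _ => ?_
      rw [mul_comm, ENNReal.ofReal_mul (Nat.cast_nonneg _), ENNReal.ofReal_natCast]
      rfl
    · intro k hk
      rw [Finset.mem_Icc, not_and_or] at hk
      have : factorizations k α = ∅ := by
        rcases hk with hk | hk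
        · rwa [show k = 0 by omega]
        · exact hempty k (by omega)
      rw [this]
      simp

lemma weight_one (m : ℕ) : weight a m 1 = 1 := by simp [weight]

lemma weight_pos (ha : PositiveRegular a) (m : ℕ) (α : FreeMonoid ι) : 0 < weight a m α := by
  induction α using FreeMonoid.inductionOn' with
  | one => rw [weight_one]; exact one_pos
  | of_mul i α ih =>
    exact (mul_pos (ha.coeff_of_pos i) ih).trans_le (weight_of_mul ha m i α)

variable {H : Type*} [NormedAddCommGroup H] [InnerProductSpace ℂ H] [CompleteSpace H]
  {A : ι → H →L[ℂ] H}

-- Induction on `k` prepends a word to the list, using `(A_γ A_β)^* = A_β^* A_γ^*`.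
open Classical in
lemma psi_iterate_eq_tsum_list (k : ℕ) (q : H → ℝ≥0∞) (h : H) :
    (psi a A)^[k] q h = ∑' L : List (FreeMonoid ι), if L.length = k then
      (L.map fun γ => ENNReal.ofReal (a γ)).prod *
        q (ContinuousLinearMap.adjoint (wordOp A L.prod) h) else 0 := by
  induction k generalizing h with
  | zero =>
    rw [tsum_eq_single [] fun L hL => if_neg (by simpa using hL)]
    simp [wordOp, ← ContinuousLinearMap.star_eq_adjoint]
  | succ k ih =>
    set F : List (FreeMonoid ι) → ℝ≥0∞ := fun L => if L.length = k + 1 then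
      (L.map fun γ => ENNReal.ofReal (a γ)).prod *
        q (ContinuousLinearMap.adjoint (wordOp A L.prod) h) else 0 with hF
    have hinj : Function.Injective
        (fun p : FreeMonoid ι × List (FreeMonoid ι) => p.1 :: p.2) := fun p p' hp =>
      Prod.ext (List.cons.inj hp).1 (List.cons.inj hp).2
    rw [Function.iterate_succ_apply', ← hinj.tsum_eq (f := F), ENNReal.tsum_prod', psi]
    · refine tsum_congr fun γ => ?_
      rw [ih, ← ENNReal.tsum_mul_left]
      refine tsum_congr fun L => ?_
      have hcomp : ContinuousLinearMap.adjoint (wordOp A (γ * L.prod)) h =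
          ContinuousLinearMap.adjoint (wordOp A L.prod)
            (ContinuousLinearMap.adjoint (wordOp A γ) h) := by
        rw [wordOp, map_mul, ContinuousLinearMap.mul_def, ContinuousLinearMap.adjoint_comp]
        rfl
      simp only [hF, List.length_cons, Nat.add_right_cancel_iff, List.map_cons, List.prod_cons,
        hcomp]
      split_ifs <;> ring
    · intro L hL
      cases L with
      | nil => simp [hF] at hL
      | cons γ L => exact ⟨(γ, L), rfl⟩

lemma psi_iterate_eq_tsum (ha : PositiveRegular a) (k : ℕ) (q : H → ℝ≥0∞) (h : H) :
    (psi a A)^[k] q h = ∑' α, ENNReal.ofReal (∑ᶠ L ∈ factorizations k α, (L.map a).prod) *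
      q (ContinuousLinearMap.adjoint (wordOp A α) h) := by
  classical
  simp_rw [ofReal_factorSum ha, ← ENNReal.tsum_mul_right]
  rw [ENNReal.tsum_comm, psi_iterate_eq_tsum_list]
  refine tsum_congr fun L => ?_
  rw [tsum_eq_single L.prod fun α hα => by rw [if_neg fun h => hα h.2.symm, zero_mul]]
  simp

/-- The weights are the coefficients of the iterated potential. -/
lemma iterate_potential_eq_tsum_weight (ha : PositiveRegular a) (m : ℕ) (q : H → ℝ≥0∞) (h : H) :
    (potential a A)^[m + 1] q h = ∑' α, ENNReal.ofReal (weight a (m + 1) α) *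
      q (ContinuousLinearMap.adjoint (wordOp A α) h) := by
  refine (psi_iterate_iterate_potential m 0 q h).trans ?_
  simp_rw [add_zero, psi_iterate_eq_tsum ha, ofReal_weight ha, ← ENNReal.tsum_mul_left,
    ← ENNReal.tsum_mul_right, mul_assoc]
  exact ENNReal.tsum_comm

end WeightedSums

/-! ### Elementary tensors in `ℓ²(κ; H)`. -/

section ElementaryTensors

variable {κ : Type*} {H : Type*} [NormedAddCommGroup H] [InnerProductSpace ℂ H]

/-- The elementary tensor `x ⊗ h`, as an element of `ℓ²(κ; H)`. -/
noncomputable def elemTensor (x : lp (fun _ : κ => ℂ) 2) (h : H) : lp (fun _ : κ => H) 2 :=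
  ⟨fun k => x k • h, (lp.memℓp ((‖h‖ : ℂ) • x)).mono' fun k => le_of_eq (by
    rw [lp.coeFn_smul, Pi.smul_apply, norm_smul, norm_smul, Complex.norm_real, norm_norm,
      mul_comm])⟩

@[simp]
lemma elemTensor_apply (x : lp (fun _ : κ => ℂ) 2) (h : H) (k : κ) :
    elemTensor x h k = x k • h := rfl

lemma elemTensor_add (x y : lp (fun _ : κ => ℂ) 2) (h : H) :
    elemTensor (x + y) h = elemTensor x h + elemTensor y h :=
  lp.ext (funext fun k => add_smul (x k) (y k) h)

lemma elemTensor_smul (c : ℂ) (x : lp (fun _ : κ => ℂ) 2) (h : H) :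
    elemTensor (c • x) h = c • elemTensor x h :=
  lp.ext (funext fun k => mul_smul c (x k) h)

lemma elemTensor_add_right (x : lp (fun _ : κ => ℂ) 2) (h h' : H) :
    elemTensor x (h + h') = elemTensor x h + elemTensor x h' :=
  lp.ext (funext fun k => smul_add (x k) h h')

lemma elemTensor_smul_right (c : ℂ) (x : lp (fun _ : κ => ℂ) 2) (h : H) :
    elemTensor x (c • h) = c • elemTensor x h :=
  lp.ext (funext fun k => smul_comm (x k) c h)

lemma inner_elemTensor (x y : lp (fun _ : κ => ℂ) 2) (h h' : H) :
    ⟪elemTensor x h, elemTensor y h'⟫_ℂ = ⟪x, y⟫_ℂ * ⟪h, h'⟫_ℂ := by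
  rw [lp.inner_eq_tsum, lp.inner_eq_tsum, ← tsum_mul_right]
  refine tsum_congr fun k => ?_
  simp only [elemTensor_apply, inner_smul_left, inner_smul_right, RCLike.inner_apply]
  ring

/-- For fixed `h`, the bounded operator `x ↦ x ⊗ h`. -/
noncomputable def elemTensorL (h : H) : lp (fun _ : κ => ℂ) 2 →L[ℂ] lp (fun _ : κ => H) 2 :=
  LinearMap.mkContinuous
    { toFun := fun x => elemTensor x h
      map_add' := fun x y => elemTensor_add x y h
      map_smul' := fun c x => elemTensor_smul c x h } ‖h‖ fun x => by
    refine le_of_eq ?_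
    rw [← sq_eq_sq₀ (norm_nonneg _) (by positivity), ← inner_self_eq_norm_sq (𝕜 := ℂ), mul_pow,
      ← inner_self_eq_norm_sq (𝕜 := ℂ) x]
    change RCLike.re ⟪elemTensor x h, elemTensor x h⟫_ℂ = _
    rw [inner_elemTensor, inner_self_eq_norm_sq_to_K (𝕜 := ℂ) h, ← RCLike.ofReal_pow, mul_comm]
    exact RCLike.re_ofReal_mul _ _

lemma eq_zero_of_inner_elemTensor {w : lp (fun _ : κ => H) 2}
    (hw : ∀ (x : lp (fun _ : κ => ℂ) 2) (h : H), ⟪elemTensor x h, w⟫_ℂ = 0) : w = 0 := by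
  classical
  refine lp.ext (funext fun k => ?_)
  have h1 : elemTensor (lp.single 2 k (1 : ℂ)) (w k) = lp.single 2 k (w k) := by
    refine lp.ext (funext fun j => ?_)
    rw [elemTensor_apply, lp.single_apply, lp.single_apply]
    by_cases hj : j = k
    · subst hj; simp
    · simp [hj]
  have h2 := hw (lp.single 2 k (1 : ℂ)) (w k)
  rw [h1, lp.inner_single_left] at h2
  simpa using h2

end ElementaryTensors

/-! ### Hilbert tensor products realized inside `ℓ²(κ; H)`. -/

section TensorIsometry

variable {κ : Type*} (H : Type*) [NormedAddCommGroup H] [InnerProductSpace ℂ H]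
  {E : Type*} [NormedAddCommGroup E] [InnerProductSpace ℂ E]
  (j : E →ₗᵢ[ℂ] lp (fun _ : κ => ℂ) 2)

/-- The linear map `E ⊗ H → ℓ²(κ; H)` induced by an isometry `E → ℓ²(κ)`. -/
noncomputable def algTensorMap : E ⊗[ℂ] H →ₗ[ℂ] lp (fun _ : κ => H) 2 :=
  TensorProduct.lift (LinearMap.mk₂ ℂ (fun (x : E) (h : H) => elemTensor (j x) h)
    (fun x y h => by rw [map_add, elemTensor_add])
    (fun c x h => by rw [map_smul, elemTensor_smul])
    (fun x h h' => elemTensor_add_right _ h h') (fun c x h => elemTensor_smul_right c _ h))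

lemma algTensorMap_tmul (x : E) (h : H) :
    algTensorMap H j (x ⊗ₜ h) = elemTensor (j x) h := rfl

lemma inner_algTensorMap (x y : E ⊗[ℂ] H) :
    ⟪algTensorMap H j x, algTensorMap H j y⟫_ℂ = ⟪x, y⟫_ℂ := by
  induction x using TensorProduct.induction_on with
  | zero => rw [map_zero, inner_zero_left, inner_zero_left]
  | add x₁ x₂ h₁ h₂ => rw [map_add, inner_add_left, inner_add_left, h₁, h₂]
  | tmul x h =>
    induction y using TensorProduct.induction_on with
    | zero => rw [map_zero, inner_zero_right, inner_zero_right]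
    | add y₁ y₂ h₁ h₂ => rw [map_add, inner_add_right, inner_add_right, h₁, h₂]
    | tmul y h' =>
      rw [algTensorMap_tmul, algTensorMap_tmul, inner_elemTensor, TensorProduct.inner_tmul,
        j.inner_map_map]

lemma norm_algTensorMap (x : E ⊗[ℂ] H) : ‖algTensorMap H j x‖ = ‖x‖ :=
  ((algTensorMap H j).isometryOfInner (inner_algTensorMap H j)).norm_map x

variable [CompleteSpace H]

/-- The bounded operator `E ⊗ H → ℓ²(κ; H)` induced by an isometry `E → ℓ²(κ)`. -/
noncomputable def tensorMapL : HilbertTensor E H →L[ℂ] lp (fun _ : κ => H) 2 :=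
  (((algTensorMap H j).isometryOfInner (inner_algTensorMap H j)).toContinuousLinearMap).extend
    (UniformSpace.Completion.toComplL : E ⊗[ℂ] H →L[ℂ] HilbertTensor E H)

lemma tensorMapL_coe (z : E ⊗[ℂ] H) :
    tensorMapL H j (z : HilbertTensor E H) = algTensorMap H j z :=
  ContinuousLinearMap.extend_eq _ UniformSpace.Completion.denseRange_coe
    (UniformSpace.Completion.isUniformInducing_coe _) z

/-- The isometry `E ⊗ H → ℓ²(κ; H)` induced by an isometry `E → ℓ²(κ)`. -/
noncomputable def tensorIsometry : HilbertTensor E H →ₗᵢ[ℂ] lp (fun _ : κ => H) 2 where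
  toLinearMap := (tensorMapL H j).toLinearMap
  norm_map' := fun z => by
    change ‖tensorMapL H j z‖ = ‖z‖
    induction z using UniformSpace.Completion.induction_on with
    | hp => exact isClosed_eq (tensorMapL H j).continuous.norm continuous_norm
    | ih z => rw [UniformSpace.Completion.norm_coe, tensorMapL_coe, norm_algTensorMap]

lemma tensorIsometry_coe_tmul (x : E) (h : H) :
    tensorIsometry H j (x ⊗ₜ[ℂ] h : E ⊗[ℂ] H) = elemTensor (j x) h :=
  tensorMapL_coe H j _

variable {H}

omit [CompleteSpace H] in
/-- Two bounded maps on a Hilbert tensor product agree if they agree on elementary tensors. -/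
lemma hilbertTensor_ext {G : Type*} [NormedAddCommGroup G] [NormedSpace ℂ G]
    {S T : HilbertTensor E H →L[ℂ] G}
    (h : ∀ (x : E) (y : H), S (x ⊗ₜ[ℂ] y : E ⊗[ℂ] H) = T (x ⊗ₜ[ℂ] y : E ⊗[ℂ] H)) : S = T := by
  ext z
  induction z using UniformSpace.Completion.induction_on with
  | hp => exact isClosed_eq S.continuous T.continuous
  | ih z =>
    induction z using TensorProduct.induction_on with
    | zero => rw [UniformSpace.Completion.coe_zero, map_zero, map_zero]
    | add x y hx hy => rw [UniformSpace.Completion.coe_add, map_add, map_add, hx, hy]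
    | tmul x y => exact h x y

omit [CompleteSpace H] in
lemma ampliation_coe_tmul (T : E →L[ℂ] E) (x : E) (y : H) :
    ampliation H T (x ⊗ₜ[ℂ] y : E ⊗[ℂ] H) = (T x ⊗ₜ[ℂ] y : E ⊗[ℂ] H) :=
  ContinuousLinearMap.extend_eq _ UniformSpace.Completion.denseRange_coe
    (UniformSpace.Completion.isUniformInducing_coe _) (x ⊗ₜ[ℂ] y)

/-- The range `U` is complete, hence has an orthogonal projection. The difference `z - P_U z` is
orthogonal to every `x ⊗ h`: split `x` along `M` and `Mᗮ`; the first part is orthogonal to both `z`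
and `U`, and the second gives a tensor in `U`. -/
lemma mem_range_tensorIsometry {M : Submodule ℂ (lp (fun _ : κ => ℂ) 2)}
    [M.HasOrthogonalProjection] {z : lp (fun _ : κ => H) 2}
    (hz : ∀ v ∈ M, ∀ h : H, ⟪elemTensor v h, z⟫_ℂ = 0) :
    ∃ w : HilbertTensor (Mᗮ : Submodule ℂ (lp (fun _ : κ => ℂ) 2)) H,
      tensorIsometry H Mᗮ.subtypeₗᵢ w = z := by
  set J := tensorIsometry H Mᗮ.subtypeₗᵢ
  have hcomplete : IsComplete (Set.range J) := by
    rw [← Set.image_univ, LinearIsometry.isComplete_image_iff]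
    exact completeSpace_iff_isComplete_univ.1 inferInstance
  have : CompleteSpace (LinearMap.range J.toLinearMap) :=
    completeSpace_coe_iff_isComplete.2 hcomplete
  set U := LinearMap.range J.toLinearMap
  have hM : ∀ v ∈ M, ∀ (h : H) w, ⟪elemTensor v h, J w⟫_ℂ = 0 := fun v hv h w => by
    have : (innerSL ℂ (elemTensor v h)) ∘L J.toContinuousLinearMap = 0 :=
      hilbertTensor_ext fun x y => by
        change ⟪elemTensor v h, J _⟫_ℂ = 0
        rw [tensorIsometry_coe_tmul, inner_elemTensor, Submodule.coe_subtypeₗᵢ, Submodule.subtype_apply,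
          Submodule.inner_right_of_mem_orthogonal hv x.2, zero_mul]
    exact congrArg (fun T => T w) this
  have hzero : z - U.starProjection z = 0 := by
    refine eq_zero_of_inner_elemTensor fun x h => ?_
    obtain ⟨w, hw⟩ : ∃ w, J w = U.starProjection z := U.starProjection_apply_mem z
    have h1 : ⟪elemTensor (M.starProjection x) h, z - U.starProjection z⟫_ℂ = 0 := by
      rw [inner_sub_right, hz _ (M.starProjection_apply_mem x), ← hw,
        hM _ (M.starProjection_apply_mem x), sub_zero]
    have h2 : ⟪elemTensor (x - M.starProjection x) h, z - U.starProjection z⟫_ℂ = 0 := by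
      refine Submodule.inner_right_of_mem_orthogonal (K := U) ?_
        (Submodule.sub_starProjection_mem_orthogonal z)
      refine ⟨((⟨x - M.starProjection x, Submodule.sub_starProjection_mem_orthogonal x⟩ :
        (Mᗮ : Submodule ℂ _)) ⊗ₜ[ℂ] h : (Mᗮ : Submodule ℂ _) ⊗[ℂ] H), ?_⟩
      exact tensorIsometry_coe_tmul H Mᗮ.subtypeₗᵢ _ _
    rw [← add_sub_cancel (M.starProjection x) x, elemTensor_add, inner_add_left, h1, h2, add_zero]
  obtain ⟨w, hw⟩ : ∃ w, J w = U.starProjection z := U.starProjection_apply_mem z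
  exact ⟨w, hw.trans (sub_eq_zero.1 hzero).symm⟩

end TensorIsometry

/-! ### Coordinates of the universal model. -/

section Model

variable {ι : Type*} {a : FreeMonoid ι → ℝ} (ha : PositiveRegular a) (m : ℕ)
  (P : Set (FreeAlgebra ℂ ι))

lemma weightedShift_basisVec (i : ι) (α : FreeMonoid ι) :
    weightedShift ha m i (basisVec α) =
      ((√(weight a m α / weight a m (FreeMonoid.of i * α)) : ℝ) : ℂ) •
        basisVec (FreeMonoid.of i * α) := by
  classical
  have hdiag : diagonalOp (fun α => √(weight a m α / weight a m (FreeMonoid.of i * α)))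
      (√(1 / a (FreeMonoid.of i))) (diagonal_bound ha m i) (basisVec α) =
        ((√(weight a m α / weight a m (FreeMonoid.of i * α)) : ℝ) : ℂ) • basisVec α := by
    refine lp.ext (funext fun β => ?_)
    change ((√(weight a m β / weight a m (FreeMonoid.of i * β)) : ℝ) : ℂ) * basisVec α β =
      ((√(weight a m α / weight a m (FreeMonoid.of i * α)) : ℝ) : ℂ) * basisVec α β
    by_cases h : β = α
    · rw [h]
    · simp [basisVec, lp.single_apply, h]
  have hcreate : leftCreation i (basisVec α) = basisVec (FreeMonoid.of i * α) := by
    refine ((orthonormal_basisVec_of_mul i).orthogonalFamily.linearIsometry_apply_single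
      (i := α) (1 : ℂ)).trans ?_
    simp
  rw [weightedShift, ContinuousLinearMap.comp_apply, hdiag, map_smul, hcreate]

lemma inner_basisVec (α : FreeMonoid ι) (x : Fock ι) : ⟪basisVec α, x⟫_ℂ = x α := by
  classical
  rw [basisVec, lp.inner_single_left]
  simp

lemma adjoint_weightedShift_apply (i : ι) (x : Fock ι) (α : FreeMonoid ι) :
    ContinuousLinearMap.adjoint (weightedShift ha m i) x α =
      ((√(weight a m α / weight a m (FreeMonoid.of i * α)) : ℝ) : ℂ) *
        x (FreeMonoid.of i * α) := by
  rw [← inner_basisVec, ContinuousLinearMap.adjoint_inner_right, weightedShift_basisVec,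
    inner_smul_left, inner_basisVec, Complex.conj_ofReal]

lemma weightedShift_mem_relationSpace (i : ι) {v : Fock ι} (hv : v ∈ relationSpace ha m P) :
    weightedShift ha m i v ∈ relationSpace ha m P := by
  have hmaps : Set.MapsTo (weightedShift ha m i)
      (Submodule.span ℂ {v | ∃ p ∈ P, ∃ α β : FreeMonoid ι,
        v = (wordOp (weightedShift ha m) α * polyOp (weightedShift ha m) p *
          wordOp (weightedShift ha m) β) (basisVec 1)} : Set (Fock ι))
      (Submodule.span ℂ {v | ∃ p ∈ P, ∃ α β : FreeMonoid ι,
        v = (wordOp (weightedShift ha m) α * polyOp (weightedShift ha m) p *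
          wordOp (weightedShift ha m) β) (basisVec 1)} : Set (Fock ι)) := by
    intro v hv
    refine (Submodule.map_span_le (weightedShift ha m i).toLinearMap _ _).2 ?_
      (Submodule.mem_map_of_mem hv)
    rintro _ ⟨p, hp, α, β, rfl⟩
    refine Submodule.subset_span ⟨p, hp, FreeMonoid.of i * α, β, ?_⟩
    simp only [wordOp, map_mul, FreeMonoid.lift_eval_of, mul_assoc]
    rfl
  exact hmaps.closure (weightedShift ha m i).continuous hv

/-- As `M_P` is invariant under `W_i`, its complement `N_P` is invariant under `W_i^*`; hence
`B_i^*` is a restriction of `W_i^*`. -/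
lemma adjoint_modelOp_apply (i : ι) (x : modelSpace ha m P) (α : FreeMonoid ι) :
    (ContinuousLinearMap.adjoint (modelOp ha m P i) x : Fock ι) α =
      ((√(weight a m α / weight a m (FreeMonoid.of i * α)) : ℝ) : ℂ) *
        (x : Fock ι) (FreeMonoid.of i * α) := by
  have hmem : ContinuousLinearMap.adjoint (weightedShift ha m i) x ∈ modelSpace ha m P := by
    rw [Submodule.mem_orthogonal]
    intro v hv
    rw [ContinuousLinearMap.adjoint_inner_right]
    exact Submodule.inner_right_of_mem_orthogonal
      (weightedShift_mem_relationSpace ha m P i hv) x.2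
  have h : ContinuousLinearMap.adjoint (modelOp ha m P i) x =
      ⟨ContinuousLinearMap.adjoint (weightedShift ha m i) x, hmem⟩ := by
    refine ext_inner_left ℂ fun y => ?_
    calc ⟪y, ContinuousLinearMap.adjoint (modelOp ha m P i) x⟫_ℂ
        = starRingEnd ℂ ⟪x, (modelSpace ha m P).orthogonalProjectionOnto
            (weightedShift ha m i y)⟫_ℂ := by
          rw [ContinuousLinearMap.adjoint_inner_right, inner_conj_symm]; rfl
      _ = ⟪weightedShift ha m i y, x⟫_ℂ := by
          rw [Submodule.inner_orthogonalProjectionOnto_eq_of_mem_left, inner_conj_symm]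
      _ = ⟪(y : Fock ι), ContinuousLinearMap.adjoint (weightedShift ha m i) x⟫_ℂ :=
          (ContinuousLinearMap.adjoint_inner_right _ _ _).symm
  rw [h, adjoint_weightedShift_apply]

variable {H : Type*} [NormedAddCommGroup H] [InnerProductSpace ℂ H] [CompleteSpace H]

/-- Turns `B_i^* ⊗ I` into a weighted backward shift on `ℓ²(𝔽; H)`, so that intertwining can be
checked coordinatewise. -/
lemma tensorIsometry_ampliation_apply (i : ι) (z : HilbertTensor (modelSpace ha m P) H)
    (α : FreeMonoid ι) :
    tensorIsometry H (modelSpace ha m P).subtypeₗᵢ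
        (ampliation H (ContinuousLinearMap.adjoint (modelOp ha m P i)) z) α =
      ((√(weight a m α / weight a m (FreeMonoid.of i * α)) : ℝ) : ℂ) •
        tensorIsometry H (modelSpace ha m P).subtypeₗᵢ z (FreeMonoid.of i * α) := by
  set J := (tensorIsometry H (modelSpace ha m P).subtypeₗᵢ).toContinuousLinearMap
  have hJt : ∀ (x : modelSpace ha m P) (h : H), J (x ⊗ₜ[ℂ] h : modelSpace ha m P ⊗[ℂ] H) =
      elemTensor (x : Fock ι) h := fun x h => tensorIsometry_coe_tmul H _ _ _
  have : lp.evalCLM ℂ (fun _ : FreeMonoid ι => H) 2 α ∘L J ∘L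
        ampliation H (ContinuousLinearMap.adjoint (modelOp ha m P i)) =
      ((√(weight a m α / weight a m (FreeMonoid.of i * α)) : ℝ) : ℂ) •
        (lp.evalCLM ℂ (fun _ : FreeMonoid ι => H) 2 (FreeMonoid.of i * α) ∘L J) := by
    refine hilbertTensor_ext fun x h => ?_
    change J (ampliation H (ContinuousLinearMap.adjoint (modelOp ha m P i)) _) α =
      ((√(weight a m α / weight a m (FreeMonoid.of i * α)) : ℝ) : ℂ) •
        J _ (FreeMonoid.of i * α)
    rw [ampliation_coe_tmul, hJt, hJt, elemTensor_apply, elemTensor_apply, adjoint_modelOp_apply,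
      mul_smul]
  exact congrArg (fun T => T z) this

end Model

/-! ### The Poisson kernel and intertwining maps. -/

section Similarity

variable {ι : Type*} {a : FreeMonoid ι → ℝ} (ha : PositiveRegular a) (m : ℕ)
  (P : Set (FreeAlgebra ℂ ι))
  {H : Type*} [NormedAddCommGroup H] [InnerProductSpace ℂ H] [CompleteSpace H]
  {A : ι → H →L[ℂ] H}

omit [CompleteSpace H] in
lemma wordOp_of_mul (i : ι) (α : FreeMonoid ι) :
    wordOp A (FreeMonoid.of i * α) = A i ∘L wordOp A α := by
  rw [wordOp, map_mul, FreeMonoid.lift_eval_of]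
  rfl

lemma adjoint_wordOp_one (h : H) : ContinuousLinearMap.adjoint (wordOp A 1) h = h := by
  rw [wordOp, map_one, ← ContinuousLinearMap.star_eq_adjoint, star_one]
  rfl

lemma adjoint_wordOp_of_mul (i : ι) (α : FreeMonoid ι) (h : H) :
    ContinuousLinearMap.adjoint (wordOp A (FreeMonoid.of i * α)) h =
      ContinuousLinearMap.adjoint (wordOp A α) (ContinuousLinearMap.adjoint (A i) h) := by
  rw [wordOp_of_mul, ContinuousLinearMap.adjoint_comp]
  rfl

include ha in
/-- A map into `ℓ²(𝔽; H)` intertwining `A*` with the adjoint of the ampliated weighted shift. -/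
lemma intertwining_wordOp {u : H →L[ℂ] lp (fun _ : FreeMonoid ι => H) 2}
    (hu : ∀ i h α, u (ContinuousLinearMap.adjoint (A i) h) α =
      ((√(weight a m α / weight a m (FreeMonoid.of i * α)) : ℝ) : ℂ) • u h (FreeMonoid.of i * α))
    (β α : FreeMonoid ι) (h : H) :
    u (ContinuousLinearMap.adjoint (wordOp A β) h) α =
      ((√(weight a m α / weight a m (β * α)) : ℝ) : ℂ) • u h (β * α) := by
  induction β using FreeMonoid.inductionOn' generalizing h with
  | one => rw [adjoint_wordOp_one, one_mul, div_self (weight_pos ha m α).ne']; simp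
  | of_mul i β ih =>
    -- The weight quotients telescope.
    rw [adjoint_wordOp_of_mul, ih, hu, smul_smul, ← Complex.ofReal_mul,
      ← Real.sqrt_mul (div_nonneg (weight_pos ha m α).le (weight_pos ha m _).le),
      div_mul_div_cancel₀ (weight_pos ha m _).ne', mul_assoc]

-- At the vacuum coordinate the intertwining reads `E A_β^* h = b_β^{-1/2} u(h)_β`; multiply the
-- squared norms by `b_β` and sum over `β`.
include ha in
lemma iterate_potential_eq_of_intertwining {u : H →L[ℂ] lp (fun _ : FreeMonoid ι => H) 2}
    (hu : ∀ i h α, u (ContinuousLinearMap.adjoint (A i) h) α =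
      ((√(weight a (m + 1) α / weight a (m + 1) (FreeMonoid.of i * α)) : ℝ) : ℂ) •
        u h (FreeMonoid.of i * α)) {E : H →L[ℂ] H} (hE : ∀ h, E h = u h 1) (h : H) :
    (potential a A)^[m + 1] (qform (ContinuousLinearMap.adjoint E ∘L E)) h = ‖u h‖ₑ ^ 2 := by
  rw [iterate_potential_eq_tsum_weight ha, enorm_sq_eq_tsum]
  refine tsum_congr fun β => ?_
  have hβ := weight_pos ha (m + 1) β
  rw [qform_adjoint_comp_self, hE, intertwining_wordOp ha (m + 1) hu, mul_one, weight_one,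
    enorm_sq_eq_ofReal, enorm_sq_eq_ofReal, ← ENNReal.ofReal_mul hβ.le, norm_smul,
    Complex.norm_real, Real.norm_eq_abs, mul_pow, sq_abs, Real.sq_sqrt (by positivity),
    ← mul_assoc, mul_one_div_cancel hβ.ne', one_mul]

lemma polyOp_intertwining {E F : Type*} [NormedAddCommGroup E] [InnerProductSpace ℂ E]
    [NormedAddCommGroup F] [InnerProductSpace ℂ F] {W : ι → E →L[ℂ] E} {B : ι → F →L[ℂ] F}
    {L : E →L[ℂ] F} (h : ∀ i, L ∘L W i = B i ∘L L) (p : FreeAlgebra ℂ ι) :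
    L ∘L polyOp W p = polyOp B p ∘L L := by
  induction p using FreeAlgebra.induction with
  | grade0 r =>
    ext x
    simp [polyOp, Algebra.algebraMap_eq_smul_one]
  | grade1 i => simpa [polyOp] using h i
  | mul p q hp hq =>
    simp only [polyOp, map_mul, ContinuousLinearMap.mul_def] at hp hq ⊢
    rw [← ContinuousLinearMap.comp_assoc, hp, ContinuousLinearMap.comp_assoc, hq,
      ContinuousLinearMap.comp_assoc]
  | add p q hp hq =>
    simp only [polyOp, map_add, ContinuousLinearMap.comp_add, ContinuousLinearMap.add_comp]
      at hp hq ⊢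
    rw [hp, hq]

lemma wordOp_intertwining {E F : Type*} [NormedAddCommGroup E] [InnerProductSpace ℂ E]
    [NormedAddCommGroup F] [InnerProductSpace ℂ F] {W : ι → E →L[ℂ] E} {B : ι → F →L[ℂ] F}
    {L : E →L[ℂ] F} (h : ∀ i, L ∘L W i = B i ∘L L) (α : FreeMonoid ι) :
    L ∘L wordOp W α = wordOp B α ∘L L := by
  induction α using FreeMonoid.inductionOn' with
  | one => simp [wordOp, ContinuousLinearMap.one_def]
  | of_mul i α ih =>
    rw [wordOp_of_mul, wordOp_of_mul, ← ContinuousLinearMap.comp_assoc, h,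
      ContinuousLinearMap.comp_assoc, ih, ContinuousLinearMap.comp_assoc]

/-- Two bounded maps on the Fock space agree if they agree on the basis vectors. -/
lemma fock_ext {F : Type*} [NormedAddCommGroup F] [NormedSpace ℂ F] {S T : Fock ι →L[ℂ] F}
    (h : ∀ α, S (basisVec α) = T (basisVec α)) : S = T := by
  classical
  ext x
  have hx := lp.hasSum_single (p := 2) (by norm_num) x
  refine (hx.mapL S).unique ((hx.mapL T).congr_fun fun α => ?_)
  have : lp.single 2 α (x α) = x α • basisVec α := by
    rw [basisVec, ← lp.single_smul, smul_eq_mul, mul_one]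
  rw [this, map_smul, map_smul, h]

omit [CompleteSpace H] in
/-- A map from the Fock space intertwining the weighted shifts with a tuple annihilated by `P`
vanishes on the relation space. -/
lemma eq_zero_of_mem_relationSpace {L : Fock ι →L[ℂ] H}
    (hL : ∀ i, L ∘L weightedShift ha m i = A i ∘L L) (hPA : ∀ p ∈ P, polyOp A p = 0)
    {v : Fock ι} (hv : v ∈ relationSpace ha m P) : L v = 0 := by
  have hle : relationSpace ha m P ≤ LinearMap.ker L.toLinearMap := by
    refine Submodule.topologicalClosure_minimal _ (Submodule.span_le.2 ?_) L.isClosed_ker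
    rintro _ ⟨p, hp, α, β, rfl⟩
    have h1 : ∀ x, L (wordOp (weightedShift ha m) α x) = wordOp A α (L x) := fun x =>
      congrArg (fun T => T x) (wordOp_intertwining hL α)
    have h2 : ∀ x, L (polyOp (weightedShift ha m) p x) = polyOp A p (L x) := fun x =>
      congrArg (fun T => T x) (polyOp_intertwining hL p)
    change L (wordOp _ α (polyOp _ p _)) = 0
    rw [h1, h2, hPA p hp, zero_apply, map_zero]
  exact hle hv

include ha in
lemma sqrt_weight_div_mul_sqrt_weight (i : ι) (α : FreeMonoid ι) :
    √(weight a m α / weight a m (FreeMonoid.of i * α)) * √(weight a m (FreeMonoid.of i * α)) =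
      √(weight a m α) := by
  rw [← Real.sqrt_mul (div_nonneg (weight_pos ha m α).le (weight_pos ha m _).le),
    div_mul_cancel₀ _ (weight_pos ha m _).ne']

include ha in
/-- The Poisson kernel `h ↦ (√b_α t A_α^* h)_α` as a map into `ℓ²(𝔽; H)`. -/
lemma exists_poissonColumn {t S : H →L[ℂ] H}
    (hSq : qform S = (potential a A)^[m + 1] (qform (ContinuousLinearMap.adjoint t ∘L t))) :
    ∃ V : H →L[ℂ] lp (fun _ : FreeMonoid ι => H) 2, (∀ h, ‖V h‖ₑ ^ 2 = qform S h) ∧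
      ∀ h α, V h α = ((√(weight a (m + 1) α) : ℝ) : ℂ) •
        t (ContinuousLinearMap.adjoint (wordOp A α) h) := by
  set T : FreeMonoid ι → H →L[ℂ] H := fun α =>
    ((√(weight a (m + 1) α) : ℝ) : ℂ) • (t ∘L ContinuousLinearMap.adjoint (wordOp A α))
  have hTapp : ∀ α h, T α h = ((√(weight a (m + 1) α) : ℝ) : ℂ) •
      t (ContinuousLinearMap.adjoint (wordOp A α) h) := fun _ _ => rfl
  have hTq : ∀ h, ∑' α, ‖T α h‖ₑ ^ 2 = qform S h := fun h => by
    rw [hSq, iterate_potential_eq_tsum_weight ha]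
    refine tsum_congr fun α => ?_
    have hα := (weight_pos ha (m + 1) α).le
    rw [qform_adjoint_comp_self, enorm_sq_eq_ofReal, enorm_sq_eq_ofReal,
      ← ENNReal.ofReal_mul hα, hTapp, norm_smul, Complex.norm_real, Real.norm_eq_abs, mul_pow,
      sq_abs, Real.sq_sqrt hα]
  obtain ⟨V, hV⟩ := exists_column T ‖S‖₊ fun h => (hTq h).trans_le (qform_le S h)
  refine ⟨V, fun h => ?_, fun h α => by rw [hV, hTapp]⟩
  rw [← hTq, enorm_sq_eq_tsum]
  exact tsum_congr fun α => by rw [hV]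

lemma adjoint_poissonColumn_elemTensor {t : H →L[ℂ] H}
    {V : H →L[ℂ] lp (fun _ : FreeMonoid ι => H) 2}
    (hV : ∀ h α, V h α = ((√(weight a m α) : ℝ) : ℂ) •
      t (ContinuousLinearMap.adjoint (wordOp A α) h)) (k : H) (α : FreeMonoid ι) :
    ContinuousLinearMap.adjoint V (elemTensor (basisVec α) k) =
      ((√(weight a m α) : ℝ) : ℂ) • wordOp A α (ContinuousLinearMap.adjoint t k) := by
  classical
  refine ext_inner_right ℂ fun h => ?_
  have hsingle : elemTensor (basisVec α) k = lp.single 2 α k := by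
    refine lp.ext (funext fun β => ?_)
    rw [elemTensor_apply, basisVec, lp.single_apply, lp.single_apply]
    by_cases hβ : β = α
    · subst hβ; simp
    · simp [hβ]
  rw [ContinuousLinearMap.adjoint_inner_left, hsingle, lp.inner_single_left, hV,
    inner_smul_left, Complex.conj_ofReal, ← ContinuousLinearMap.adjoint_inner_right,
    ContinuousLinearMap.adjoint_inner_left]
  exact inner_smul_right _ _ _

/-- For fixed `k`, the map `x ↦ V^*(x ⊗ k)` intertwines `W_i` with `A_i`, hence kills `M_P`. This
confines the range of the Poisson kernel to `N_P ⊗ H`. -/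
lemma inner_elemTensor_poissonColumn (hPA : ∀ p ∈ P, polyOp A p = 0) {t : H →L[ℂ] H}
    {V : H →L[ℂ] lp (fun _ : FreeMonoid ι => H) 2}
    (hV : ∀ h α, V h α = ((√(weight a m α) : ℝ) : ℂ) •
      t (ContinuousLinearMap.adjoint (wordOp A α) h)) {v : Fock ι}
    (hv : v ∈ relationSpace ha m P) (k h : H) : ⟪elemTensor v k, V h⟫_ℂ = 0 := by
  obtain ⟨L, hL⟩ : ∃ L : Fock ι →L[ℂ] H,
      ∀ x, L x = ContinuousLinearMap.adjoint V (elemTensor x k) :=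
    ⟨ContinuousLinearMap.adjoint V ∘L elemTensorL k, fun _ => rfl⟩
  have hLapp : ∀ α, L (basisVec α) = ((√(weight a m α) : ℝ) : ℂ) •
      wordOp A α (ContinuousLinearMap.adjoint t k) := fun α =>
    (hL _).trans (adjoint_poissonColumn_elemTensor m hV k α)
  have hLint : ∀ i, L ∘L weightedShift ha m i = A i ∘L L := fun i => by
    refine fock_ext fun α => ?_
    rw [ContinuousLinearMap.comp_apply, weightedShift_basisVec, map_smul,
      ContinuousLinearMap.comp_apply, hLapp, hLapp, map_smul, smul_smul, ← Complex.ofReal_mul,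
      sqrt_weight_div_mul_sqrt_weight ha, wordOp_of_mul]
    rfl
  rw [← ContinuousLinearMap.adjoint_inner_left, ← hL, eq_zero_of_mem_relationSpace ha m P hLint hPA hv, inner_zero_left]

/-- The Poisson kernel: a positive `S` which is the iterated potential of a positive `R` is
implemented by a map into the ampliated model space that intertwines the adjoints. -/
lemma exists_poissonKernel (hPA : ∀ p ∈ P, polyOp A p = 0) {R S : H →L[ℂ] H} (hR : R.IsPositive)
    (hSq : qform S = (potential a A)^[m + 1] (qform R)) :
    ∃ K : H →L[ℂ] HilbertTensor (modelSpace ha (m + 1) P) H,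
      (∀ h, ‖K h‖ₑ ^ 2 = qform S h) ∧
      ∀ i h, ampliation H (ContinuousLinearMap.adjoint (modelOp ha (m + 1) P i)) (K h) =
        K (ContinuousLinearMap.adjoint (A i) h) := by
  obtain ⟨t, rfl⟩ := exists_eq_adjoint_comp_self hR
  obtain ⟨V, hVq, hV⟩ := exists_poissonColumn ha m hSq
  -- Supplies the orthogonal projection onto `M_P` needed by `mem_range_tensorIsometry`.
  have : CompleteSpace (relationSpace ha (m + 1) P) :=
    (Submodule.isClosed_topologicalClosure _).completeSpace_coe
  set J := tensorIsometry H (modelSpace ha (m + 1) P).subtypeₗᵢ with hJ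
  have hmem : ∀ h, V h ∈ LinearMap.range J.toLinearMap := fun h =>
    mem_range_tensorIsometry fun v hv k =>
      inner_elemTensor_poissonColumn ha (m + 1) P hPA hV hv k h
  obtain ⟨K, hJK⟩ : ∃ K : H →L[ℂ] HilbertTensor (modelSpace ha (m + 1) P) H,
      ∀ h, J (K h) = V h :=
    ⟨(J.equivRange.symm.toContinuousLinearEquiv : _ →L[ℂ] _) ∘L V.codRestrict _ hmem, fun h =>
      congrArg Subtype.val (J.equivRange.apply_symm_apply ⟨V h, hmem h⟩)⟩
  refine ⟨K, fun h => ?_, fun i h => ?_⟩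
  · rw [← hVq, ← hJK, enorm_sq_eq_ofReal, enorm_sq_eq_ofReal, J.norm_map]
  · refine J.injective (lp.ext (funext fun α => ?_))
    rw [hJ, tensorIsometry_ampliation_apply, ← hJ, hJK, hJK, hV, hV, smul_smul,
      ← Complex.ofReal_mul, sqrt_weight_div_mul_sqrt_weight ha, adjoint_wordOp_of_mul]

end Similarity

/-! ### Two-sided bounds and the passage between similarities and potentials. -/

section MainTheorem

variable {ι : Type*} {a : FreeMonoid ι → ℝ} (ha : PositiveRegular a) (m : ℕ)
  (P : Set (FreeAlgebra ℂ ι))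
  {H : Type*} [NormedAddCommGroup H] [InnerProductSpace ℂ H] [CompleteSpace H]
  {A : ι → H →L[ℂ] H}

omit [CompleteSpace H] in
lemma reApplyInnerSelf_smul_one (c : ℝ) (h : H) :
    ((c : ℂ) • (1 : H →L[ℂ] H)).reApplyInnerSelf h = c * ‖h‖ ^ 2 := by
  rw [ContinuousLinearMap.reApplyInnerSelf_apply]
  change RCLike.re ⟪(c : ℂ) • h, h⟫_ℂ = _
  rw [inner_smul_left, Complex.conj_ofReal, ← inner_self_eq_norm_sq (𝕜 := ℂ)]
  exact Complex.re_ofReal_mul _ _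

omit [CompleteSpace H] in
lemma isSymmetric_smul_one (c : ℝ) :
    (((c : ℂ) • (1 : H →L[ℂ] H) : H →L[ℂ] H) : H →ₗ[ℂ] H).IsSymmetric := fun x y => by
  change ⟪(c : ℂ) • x, y⟫_ℂ = ⟪x, (c : ℂ) • y⟫_ℂ
  rw [inner_smul_left, inner_smul_right, Complex.conj_ofReal]

omit [CompleteSpace H] in
lemma le_iff_reApplyInnerSelf_le {S T : H →L[ℂ] H} (hS : (S : H →ₗ[ℂ] H).IsSymmetric)
    (hT : (T : H →ₗ[ℂ] H).IsSymmetric) :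
    S ≤ T ↔ ∀ h, S.reApplyInnerSelf h ≤ T.reApplyInnerSelf h := by
  have hsub : ∀ h, (T - S).reApplyInnerSelf h = T.reApplyInnerSelf h - S.reApplyInnerSelf h :=
    fun h => by simp [ContinuousLinearMap.reApplyInnerSelf_apply, inner_sub_left]
  rw [ContinuousLinearMap.le_def, ContinuousLinearMap.isPositive_def]
  constructor
  · intro h x
    have := h.2 x
    rw [hsub] at this
    linarith
  · intro h
    refine ⟨hT.sub hS, fun x => ?_⟩
    rw [hsub]
    linarith [h x]

omit [CompleteSpace H] in
lemma isPositive_of_smul_one_le {c : ℝ} (hc : 0 ≤ c) {S : H →L[ℂ] H}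
    (h : (c : ℂ) • (1 : H →L[ℂ] H) ≤ S) : S.IsPositive := by
  have h1 : ((c : ℂ) • (1 : H →L[ℂ] H)).IsPositive :=
    ⟨isSymmetric_smul_one c, fun x => by rw [reApplyInnerSelf_smul_one]; positivity⟩
  rw [← sub_add_cancel S ((c : ℂ) • (1 : H →L[ℂ] H))]
  exact ContinuousLinearMap.IsPositive.add ((ContinuousLinearMap.le_def _ _).1 h) h1

omit [CompleteSpace H] in
lemma mul_norm_sq_le_of_smul_one_le {c : ℝ} (hc : 0 ≤ c) {S : H →L[ℂ] H}
    (h : (c : ℂ) • (1 : H →L[ℂ] H) ≤ S) (x : H) : c * ‖x‖ ^ 2 ≤ S.reApplyInnerSelf x := by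
  rw [← reApplyInnerSelf_smul_one]
  exact (le_iff_reApplyInnerSelf_le (isSymmetric_smul_one c)
    (isPositive_of_smul_one_le hc h).isSymmetric).1 h x

omit [CompleteSpace H] in
/-- A positive operator that is bounded below by `c` has two-sided bounds. -/
lemma exists_bounds {S : H →L[ℂ] H} (hS : S.IsPositive) {c : ℝ}
    (h : ∀ x, c * ‖x‖ ^ 2 ≤ S.reApplyInnerSelf x) :
    ∃ d : ℝ, c ≤ d ∧ (c : ℂ) • (1 : H →L[ℂ] H) ≤ S ∧ S ≤ (d : ℂ) • (1 : H →L[ℂ] H) := by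
  -- The maximum secures `c ≤ d` even for trivial `H`, where `‖S‖ = 0`.
  refine ⟨max c ‖S‖, le_max_left _ _,
    (le_iff_reApplyInnerSelf_le (isSymmetric_smul_one c) hS.isSymmetric).2 fun x => ?_,
    (le_iff_reApplyInnerSelf_le hS.isSymmetric (isSymmetric_smul_one _)).2 fun x => ?_⟩
  · rw [reApplyInnerSelf_smul_one]; exact h x
  · rw [reApplyInnerSelf_smul_one]
    calc S.reApplyInnerSelf x ≤ ‖⟪S x, x⟫_ℂ‖ := Complex.re_le_norm _
      _ ≤ ‖S x‖ * ‖x‖ := norm_inner_le_norm _ _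
      _ ≤ ‖S‖ * ‖x‖ * ‖x‖ := by gcongr; exact S.le_opNorm x
      _ = ‖S‖ * ‖x‖ ^ 2 := by ring
      _ ≤ _ := by gcongr; exact le_max_right _ _

/-- An invertible positive operator is bounded below. -/
lemma exists_lower_bound_of_isUnit {Q : H →L[ℂ] H} (hQ : Q.IsPositive) (hu : IsUnit Q) :
    ∃ c : ℝ, 0 < c ∧ ∀ x, c * ‖x‖ ^ 2 ≤ Q.reApplyInnerSelf x := by
  obtain ⟨t, rfl⟩ := exists_eq_adjoint_comp_self hQ
  obtain ⟨u, hu⟩ := hu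
  -- `B = Q⁻¹ t^*` is a left inverse of `t`; using `‖B‖ + 1` below avoids inverting zero.
  set B : H →L[ℂ] H := (↑u⁻¹ : H →L[ℂ] H) ∘L ContinuousLinearMap.adjoint t
  have hleft : ∀ x, B (t x) = x := fun x => by
    have : (↑u⁻¹ : H →L[ℂ] H) * (ContinuousLinearMap.adjoint t ∘L t) = 1 := by
      rw [← hu, Units.inv_mul]
    exact congrArg (fun T => T x) this
  refine ⟨((‖B‖ + 1) ^ 2)⁻¹, by positivity, fun x => ?_⟩
  have hre : (ContinuousLinearMap.adjoint t ∘L t).reApplyInnerSelf x = ‖t x‖ ^ 2 := by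
    rw [ContinuousLinearMap.reApplyInnerSelf_apply, ContinuousLinearMap.comp_apply,
      ContinuousLinearMap.adjoint_inner_left, inner_self_eq_norm_sq (𝕜 := ℂ)]
  rw [hre, inv_mul_le_iff₀ (by positivity), ← mul_pow]
  gcongr
  calc ‖x‖ = ‖B (t x)‖ := by rw [hleft]
    _ ≤ ‖B‖ * ‖t x‖ := B.le_opNorm _
    _ ≤ _ := by gcongr; linarith

omit [CompleteSpace H] in
lemma eq_symm_comp_restrict_comp_iff {K : Type*} [NormedAddCommGroup K] [InnerProductSpace ℂ K]
    {G : Submodule ℂ K} {T : K →L[ℂ] K} (hT : ∀ x ∈ G, T x ∈ G) (Y : H ≃L[ℂ] G) (B : H →L[ℂ] H) :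
    B = (Y.symm : G →L[ℂ] H) ∘L T.restrict hT ∘L (Y : H →L[ℂ] G) ↔
      ∀ x, T (Y x) = (Y (B x) : K) := by
  constructor
  · intro h x
    rw [h]
    exact (congrArg Subtype.val (Y.apply_symm_apply (T.restrict hT (Y x)))).symm
  · intro h
    ext x
    exact (Y.symm_apply_eq.2 (Subtype.ext (h x))).symm

-- Invariance of `G` comes for free from the intertwining, because `Y` is onto `G`.
omit [CompleteSpace H] in
lemma mem_of_forall_apply_coe_eq {K : Type*} [NormedAddCommGroup K] [InnerProductSpace ℂ K]
    {G : Submodule ℂ K} {T : K →L[ℂ] K} (Y : H ≃L[ℂ] G) (B : H →L[ℂ] H)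
    (h : ∀ x, T (Y x) = (Y (B x) : K)) {x : K} (hx : x ∈ G) : T x ∈ G := by
  obtain ⟨y, hy⟩ := Y.surjective ⟨x, hx⟩
  rw [show x = Y y from congrArg Subtype.val hy.symm, h]
  exact Subtype.property _

/-- The Gram operator of an isomorphism onto a subspace has two-sided bounds. -/
lemma exists_gram_bounds {K : Type*} [NormedAddCommGroup K] [InnerProductSpace ℂ K]
    [CompleteSpace K] {G : Submodule ℂ K} (Y : H ≃L[ℂ] G) :
    ∃ (V : H →L[ℂ] K) (c d : ℝ), (∀ x, V x = Y x) ∧ 0 < c ∧ c ≤ d ∧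
      (c : ℂ) • (1 : H →L[ℂ] H) ≤ ContinuousLinearMap.adjoint V ∘L V ∧
      ContinuousLinearMap.adjoint V ∘L V ≤ (d : ℂ) • (1 : H →L[ℂ] H) := by
  obtain ⟨V, hV⟩ : ∃ V : H →L[ℂ] K, ∀ x, V x = Y x :=
    ⟨G.subtypeL ∘L (Y : H →L[ℂ] G), fun _ => rfl⟩
  have hlow : ∀ x, ((‖(Y.symm : G →L[ℂ] H)‖ + 1) ^ 2)⁻¹ * ‖x‖ ^ 2 ≤
      (ContinuousLinearMap.adjoint V ∘L V).reApplyInnerSelf x := by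
    intro x
    have hnorm : ‖V x‖ = ‖Y x‖ := by rw [hV]; rfl
    rw [ContinuousLinearMap.reApplyInnerSelf_apply, ContinuousLinearMap.comp_apply,
      ContinuousLinearMap.adjoint_inner_left, inner_self_eq_norm_sq (𝕜 := ℂ), hnorm,
      inv_mul_le_iff₀ (by positivity), ← mul_pow]
    gcongr
    calc ‖x‖ = ‖(Y.symm : G →L[ℂ] H) (Y x)‖ := by
          rw [ContinuousLinearEquiv.coe_coe, Y.symm_apply_apply]
      _ ≤ ‖(Y.symm : G →L[ℂ] H)‖ * ‖Y x‖ := ContinuousLinearMap.le_opNorm _ _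
      _ ≤ _ := by gcongr; linarith
  obtain ⟨d, hcd, h1, h2⟩ :=
    exists_bounds (ContinuousLinearMap.isPositive_adjoint_comp_self V) hlow
  exact ⟨V, _, d, hV, by positivity, hcd, h1, h2⟩

/-- A similarity to a part of the adjoint of the ampliated universal model yields a positive
operator whose iterated potential is bounded and bounded below. -/
lemma exists_potential_of_similarity
    {V : H →L[ℂ] HilbertTensor (modelSpace ha (m + 1) P) H}
    (hV : ∀ i h, V (ContinuousLinearMap.adjoint (A i) h) =
      ampliation H (ContinuousLinearMap.adjoint (modelOp ha (m + 1) P i)) (V h)) :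
    ∃ R : H →L[ℂ] H, R.IsPositive ∧
      qform (ContinuousLinearMap.adjoint V ∘L V) = (potential a A)^[m + 1] (qform R) := by
  set J := tensorIsometry H (modelSpace ha (m + 1) P).subtypeₗᵢ with hJ
  set u : H →L[ℂ] lp (fun _ : FreeMonoid ι => H) 2 := J.toContinuousLinearMap ∘L V
  have hu : ∀ h, u h = J (V h) := fun _ => rfl
  -- The vacuum coordinate of `u`, which determines all the others.
  set E : H →L[ℂ] H := lp.evalCLM ℂ (fun _ : FreeMonoid ι => H) 2 1 ∘L u
  refine ⟨ContinuousLinearMap.adjoint E ∘L E,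
    ContinuousLinearMap.isPositive_adjoint_comp_self E, funext fun h => ?_⟩
  rw [qform_adjoint_comp_self, iterate_potential_eq_of_intertwining ha m (u := u)
    (fun i h α => by rw [hu, hu, hV, hJ, tensorIsometry_ampliation_apply]) (fun h => rfl) h, hu,
    enorm_sq_eq_ofReal, enorm_sq_eq_ofReal, J.norm_map]

/-- An iterated potential that is bounded below yields a similarity to a part of the adjoint of the
ampliated universal model. -/
lemma exists_similarity_of_potential (hPA : ∀ p ∈ P, polyOp A p = 0) {R S : H →L[ℂ] H}
    (hR : R.IsPositive) (hSq : qform S = (potential a A)^[m + 1] (qform R)) {c : ℝ} (hc : 0 < c)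
    (hcS : (c : ℂ) • (1 : H →L[ℂ] H) ≤ S) :
    ∃ (G : Submodule ℂ (HilbertTensor (modelSpace ha (m + 1) P) H)) (Y : H ≃L[ℂ] G),
      IsClosed (G : Set (HilbertTensor (modelSpace ha (m + 1) P) H)) ∧
      ∀ i h, ampliation H (ContinuousLinearMap.adjoint (modelOp ha (m + 1) P i)) (Y h) =
        (Y (ContinuousLinearMap.adjoint (A i) h) :
          HilbertTensor (modelSpace ha (m + 1) P) H) := by
  have hS := isPositive_of_smul_one_le hc.le hcS
  obtain ⟨K, hKq, hKA⟩ := exists_poissonKernel ha m P hPA hR hSq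
  -- From `c ‖x‖² ≤ ⟪S x, x⟫ = ‖K x‖²`; it makes `K` injective with closed range.
  have hbelow : ∀ x, ‖x‖ ≤ (NNReal.sqrt (Real.toNNReal c⁻¹) : ℝ) * ‖K x‖ := fun x => by
    have h1 : c * ‖x‖ ^ 2 ≤ ‖K x‖ ^ 2 := by
      have h2 := hKq x
      rw [enorm_sq_eq_ofReal, qform,
        ENNReal.ofReal_eq_ofReal_iff (by positivity) (hS.2 x)] at h2
      exact (mul_norm_sq_le_of_smul_one_le hc.le hcS x).trans h2.ge
    rw [Real.coe_sqrt, Real.coe_toNNReal _ (by positivity), ← Real.sqrt_sq (norm_nonneg x),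
      ← Real.sqrt_sq (norm_nonneg (K x)), ← Real.sqrt_mul (by positivity)]
    refine Real.sqrt_le_sqrt ?_
    rwa [← inv_mul_le_iff₀ (by positivity), inv_inv]
  have hanti := K.antilipschitz_of_bound hbelow
  have hclosed : IsClosed (Set.range K) := hanti.isClosed_range K.uniformContinuous
  exact ⟨_, K.equivRange hanti.injective hclosed, hclosed, hKA⟩

end MainTheorem

end NCVariety

set_option maxHeartbeats 1000000 in
theorem mainTheorem2 {ι : Type*} [Countable ι] [Nonempty ι]
    {H : Type*} [NormedAddCommGroup H] [InnerProductSpace ℂ H] [CompleteSpace H]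
    (m : ℕ) (hm : 1 ≤ m)
    (a : FreeMonoid ι → ℝ) (ha : NCVariety.PositiveRegular a)
    (P : Set (FreeAlgebra ℂ ι)) (hP : NCVariety.modelSpace ha m P ≠ ⊥)
    (A : ι → H →L[ℂ] H)
    (hA : Summable (NCVariety.phiTerm a A 1))
    (hPA : ∀ p ∈ P, NCVariety.polyOp A p = 0) :
    List.TFAE [
      -- (i) joint similarity to a part of the adjoint of the ampliated universal model
      ∃ (G : Submodule ℂ (NCVariety.HilbertTensor (NCVariety.modelSpace ha m P) H))
        (hG : ∀ i, ∀ x ∈ G, NCVariety.ampliation H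
          (ContinuousLinearMap.adjoint (NCVariety.modelOp ha m P i)) x ∈ G)
        (Y : H ≃L[ℂ] G),
        IsClosed (G : Set (NCVariety.HilbertTensor (NCVariety.modelSpace ha m P) H)) ∧
        ∀ i, ContinuousLinearMap.adjoint (A i) =
          (Y.symm : G →L[ℂ] H) ∘L
            (NCVariety.ampliation H
              (ContinuousLinearMap.adjoint (NCVariety.modelOp ha m P i))).restrict (hG i) ∘L
            (Y : H →L[ℂ] G),
      -- (ii) an invertible element of the cone on which the iterates vanish strongly
      ∃ Q : H →L[ℂ] H, IsUnit Q ∧ NCVariety.MemCone a m A Q ∧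
        ∀ h : H, Filter.Tendsto (fun k : ℕ => ((NCVariety.phi a A)^[k] Q) h)
          Filter.atTop (nhds 0),
      -- (iii) two-sided bounds for a series of iterates, convergent in the weak operator topology
      ∃ (c d : ℝ) (R S : H →L[ℂ] H), 0 < c ∧ c ≤ d ∧ R.IsPositive ∧
        HasSum (fun k : ℕ => ContinuousLinearMapWOT.ofCLM
          (((k + m - 1).choose (m - 1) : ℂ) • ((NCVariety.phi a A)^[k] R)))
          (ContinuousLinearMapWOT.ofCLM S) ∧
        (c : ℂ) • (1 : H →L[ℂ] H) ≤ S ∧ S ≤ (d : ℂ) • (1 : H →L[ℂ] H)] := by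
  -- Removes the truncated subtractions: the binomial becomes `(k+n choose n)` by definition.
  obtain ⟨m, rfl⟩ : ∃ n, m = n + 1 := ⟨m - 1, by omega⟩
  tfae_have 1 → 3 := by
    rintro ⟨G, hG, Y, -, hY⟩
    obtain ⟨V, c, d, hV, hc, hcd, h1, h2⟩ := NCVariety.exists_gram_bounds Y
    obtain ⟨R, hR, hq⟩ := NCVariety.exists_potential_of_similarity ha m P (A := A) (V := V)
      fun i h => by
        rw [hV, hV]
        exact ((NCVariety.eq_symm_comp_restrict_comp_iff (hG i) Y _).1 (hY i) h).symm
    exact ⟨c, d, R, _, hc, hcd, hR,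
      (NCVariety.hasSum_choose_smul_phi_iterate_iff ha.nonneg hA hR
        (NCVariety.isPositive_of_smul_one_le hc.le h1) m).2 hq, h1, h2⟩
  tfae_have 3 → 1 := by
    rintro ⟨c, d, R, S, hc, -, hR, hsum, hcS, -⟩
    have hS := NCVariety.isPositive_of_smul_one_le hc.le hcS
    obtain ⟨G, Y, hclosed, hYA⟩ := NCVariety.exists_similarity_of_potential ha m P hPA hR
      ((NCVariety.hasSum_choose_smul_phi_iterate_iff ha.nonneg hA hR hS m).1 hsum) hc hcS
    exact ⟨G, fun i x hx => NCVariety.mem_of_forall_apply_coe_eq Y _ (hYA i) hx, Y, hclosed,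
      fun i => (NCVariety.eq_symm_comp_restrict_comp_iff _ Y _).2 (hYA i)⟩
  tfae_have 2 → 3 := by
    rintro ⟨Q, hu, hQ, hlim⟩
    -- The last defect of `Q` serves as `R`, and `Q` itself as the sum `S`.
    have hR : ((fun Y => Y - NCVariety.phi a A Y)^[m + 1] Q).IsPositive :=
      hQ.2 (m + 1) (by omega) le_rfl
    obtain ⟨c, hc, hlow⟩ := NCVariety.exists_lower_bound_of_isUnit hQ.1 hu
    obtain ⟨d, hcd, h1, h2⟩ := NCVariety.exists_bounds hQ.1 hlow
    exact ⟨c, d, _, Q, hc, hcd, hR,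
      (NCVariety.hasSum_choose_smul_phi_iterate_iff ha.nonneg hA hR hQ.1 m).2
        (NCVariety.qform_eq_potential_of_memCone ha.nonneg hA hQ hlim), h1, h2⟩
  tfae_have 3 → 2 := by
    rintro ⟨c, d, R, S, hc, -, hR, hsum, hcS, -⟩
    have hS := NCVariety.isPositive_of_smul_one_le hc.le hcS
    have hq := (NCVariety.hasSum_choose_smul_phi_iterate_iff ha.nonneg hA hR hS m).1 hsum
    refine ⟨S, ?_, NCVariety.memCone_of_qform_eq_potential ha.nonneg hA hR hS hq,
      NCVariety.tendsto_phi_iterate_of_qform_eq_potential ha.nonneg hA hS hq⟩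
    -- Coercivity of `S` yields invertibility.
    refine S.isUnit_of_forall_le_norm_inner_map (c := ⟨c, hc.le⟩) hc fun x => ?_
    rw [mul_comm]
    exact (NCVariety.mul_norm_sq_le_of_smul_one_le hc.le hcS x).trans (Complex.re_le_norm _)
  tfae_finish
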